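/- Let $J\subseteq\mathbb R$ be an interval (of any kind), let $f:J\to(-\infty,\infty]$ be a Borel function that is bounded from below on every compact subset of $J$, and assume that $f(t)<\infty$ for at least two points $t\in J$. For a complex Hilbert space $H$ let $B(H)_*^+$ be the set of normal positive linear functionals on $B(H)$, and for a bounded self-adjoint operator $A$ on $H$ with spectral measure $E_A$ and spectrum $\sigma(A)\subseteq J$ put $$f(A)(\rho)=\int_{\sigma(A)}f(t)\,d\rho(E_A(t))\in(-\infty,\infty],\qquad \rho\in B(H)_*^+,$$ where $T_1\le T_2$ for such maps means $T_1(\rho)\le T_2(\rho)$ for all $\rho\in B(H)_*^+$. For an interval $J'\subseteq J$ call $f$ *operator convex on $J'$* if $f((1-\lambda)A+\lambda B)\le(1-\lambda)f(A)+\lambda f(B)$ for all $\lambda\in(0,1)$, all Hilbert spaces $H$ and all bounded self-adjoint $A,B$ on $H$ with spectra in $J'$; call $f$ *operator monotone on $J'$* if $A\le B$ implies $f(A)\le f(B)$ for all such $H,A,B$. Let $a=\inf J$, $b=\sup J$, let $J^\circ$ be the interior of $J$, and write $f(a^+)=\lim_{t\searrow a}f(t)$, $f(b^-)=\lim_{t\nearrow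 b}f(t)$. An inequality below that involves one of these limits includes the assertion that the limit exists in $(-\infty,\infty]$. (1) The following are equivalent: (i) $f$ is operator convex on $J$; (ii) $f$ is real-valued and operator convex on $J^\circ$, $f(a)\ge f(a^+)$ if $a\in J$, and $f(b)\ge f(b^-)$ if $b\in J$. (2) The following are equivalent: (i') $f$ is operator monotone on $J$; (ii') $f$ is real-valued and operator monotone on $J^\circ$, $f(a)\le f(a^+)$ if $a\in J$, and $f(b)\ge f(b^-)$ if $b\in J$. -/

import Mathlib

open scoped ComplexOrder Topology ENNReal CompactlySupported
open MeasureTheory Filter Set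

universe u

/-- The positive part `B(H)_*^+` of the predual of `B(H)`: normal positive linear functionals, i.e.
positive linear functionals `ρ` on `B(H)` that preserve suprema of (bounded) increasing nets of
self-adjoint operators. Operators carry the Loewner order. -/
structure NormalPositiveFunctional (H : Type*) [NormedAddCommGroup H] [InnerProductSpace ℂ H]
    [CompleteSpace H] where
  toFun : (H →L[ℂ] H) →ₗ[ℂ] ℂ
  nonneg : ∀ X : H →L[ℂ] H, 0 ≤ X → 0 ≤ toFun X
  normal : ∀ (S : Set (H →L[ℂ] H)) (X : H →L[ℂ] H), S.Nonempty → (∀ T ∈ S, IsSelfAdjoint T) →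
    DirectedOn (· ≤ ·) S → IsLUB S X → IsLUB ((fun T => (toFun T).re) '' S) (toFun X).re

section SpectralMeasure

variable {H : Type*} [NormedAddCommGroup H] [InnerProductSpace ℂ H] [CompleteSpace H]

/-- The positive linear functional `g ↦ ρ(g(A))` on `C_c(ℝ)`, where `g(A)` is the continuous
functional calculus. -/
noncomputable def cfcFunctional (A : H →L[ℂ] H) (ρ : NormalPositiveFunctional H) :
    C_c(ℝ, ℝ) →ₚ[ℝ] ℝ :=
  PositiveLinearMap.mk₀
    { toFun := fun g => (ρ.toFun (cfc (g : ℝ → ℝ) A)).re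
      map_add' := fun g h => by
        have e : ((g + h : C_c(ℝ, ℝ)) : ℝ → ℝ) = fun x => g x + h x := rfl
        rw [e, cfc_add (a := A) (f := (g : ℝ → ℝ)) (g := (h : ℝ → ℝ))
          (hf := g.continuous.continuousOn) (hg := h.continuous.continuousOn)]
        simp
      map_smul' := fun c g => by
        have e : ((c • g : C_c(ℝ, ℝ)) : ℝ → ℝ) = fun x => c • g x := rfl
        rw [e, cfc_smul (a := A) (s := c) (f := (g : ℝ → ℝ)) (hf := g.continuous.continuousOn),
          ← Complex.coe_smul c, map_smul]
        simp }
    (fun g hg => by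
      have h0 : (0 : H →L[ℂ] H) ≤ cfc (g : ℝ → ℝ) A := cfc_nonneg (fun x _ => hg x)
      exact (Complex.le_def.mp (ρ.nonneg _ h0)).1)

/-- The scalar spectral measure `ρ ∘ E_A` on `ℝ` of a self-adjoint operator `A`, where `E_A` is the
spectral measure of `A`: the Borel measure with `∫ g d(ρ ∘ E_A) = ρ(g(A))` for `g ∈ C_c(ℝ)`, given
by the Riesz representation theorem. -/
noncomputable def scalarSpectralMeasure (A : H →L[ℂ] H) (ρ : NormalPositiveFunctional H) :
    Measure ℝ :=
  RealRMK.rieszMeasure (cfcFunctional A ρ)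

/-- The defining property of the scalar spectral measure. -/
theorem integral_scalarSpectralMeasure (A : H →L[ℂ] H) (ρ : NormalPositiveFunctional H)
    (g : C_c(ℝ, ℝ)) :
    ∫ t, g t ∂(scalarSpectralMeasure A ρ) = (ρ.toFun (cfc (g : ℝ → ℝ) A)).re :=
  RealRMK.integral_rieszMeasure (cfcFunctional A ρ) g

/-- `f(A)` as a map on `B(H)_*^+`: `f(A)(ρ) = ∫_{σ(A)} f(t) dρ(E_A(t)) ∈ (-∞, ∞]`, the integral
being that of the positive part minus that of the negative part. (The latter is finite when `f` is
bounded below on `σ(A)`.) -/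
noncomputable def extApply (f : ℝ → EReal) (A : H →L[ℂ] H) (ρ : NormalPositiveFunctional H) :
    EReal :=
  ((∫⁻ t in spectrum ℝ A, (f t).toENNReal ∂(scalarSpectralMeasure A ρ) : ℝ≥0∞) : EReal)
    - ((∫⁻ t in spectrum ℝ A, (-(f t)).toENNReal ∂(scalarSpectralMeasure A ρ) : ℝ≥0∞) : EReal)

end SpectralMeasure

/-- `f` is bounded from below on every compact subset of `J`. -/
def LocallyBoundedBelowOn (f : ℝ → EReal) (J : Set ℝ) : Prop :=
  ∀ K : Set ℝ, K ⊆ J → IsCompact K → ∃ c : ℝ, ∀ t ∈ K, (c : EReal) ≤ f t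

/-- `B(H)_J`: the self-adjoint operators on `H` with spectrum in `J`. -/
def selfAdjointWithSpectrumIn (H : Type*) [NormedAddCommGroup H] [InnerProductSpace ℂ H]
    [CompleteSpace H] (J : Set ℝ) : Set (H →L[ℂ] H) :=
  {A | IsSelfAdjoint A ∧ spectrum ℝ A ⊆ J}

/-- Operator convexity on `J` of an extended-valued function:
`f((1-r)A + rB) ≤ (1-r) f(A) + r f(B)`, the order being pointwise on `B(H)_*^+`. -/
def ExtOperatorConvexOn (f : ℝ → EReal) (J : Set ℝ) : Prop :=
  ∀ (H : Type u) [NormedAddCommGroup H] [InnerProductSpace ℂ H] [CompleteSpace H],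
    ∀ A ∈ selfAdjointWithSpectrumIn H J, ∀ B ∈ selfAdjointWithSpectrumIn H J,
    ∀ r : ℝ, 0 < r → r < 1 → ∀ ρ : NormalPositiveFunctional H,
      extApply f ((1 - r) • A + r • B) ρ
        ≤ ((1 - r : ℝ) : EReal) * extApply f A ρ + (r : EReal) * extApply f B ρ

/-- Operator monotonicity on `J` of an extended-valued function: `A ≤ B` implies `f(A) ≤ f(B)`,
the latter order being pointwise on `B(H)_*^+`. -/
def ExtOperatorMonotoneOn (f : ℝ → EReal) (J : Set ℝ) : Prop :=
  ∀ (H : Type u) [NormedAddCommGroup H] [InnerProductSpace ℂ H] [CompleteSpace H],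
    ∀ A ∈ selfAdjointWithSpectrumIn H J, ∀ B ∈ selfAdjointWithSpectrumIn H J, A ≤ B →
    ∀ ρ : NormalPositiveFunctional H, extApply f A ρ ≤ extApply f B ρ

/-! Necessity comes from testing on small explicit matrices with vector states. Scalar operators
give ordinary convexity or monotonicity of `f`, hence one-sided limits at the ends and their
comparison with the end values. Finiteness in the interior needs noncommutativity. For convexity,
two real symmetric 3×3 matrices have a common vector supported on their eigenvalues ±15, while for
their midpoint the same vector charges 24 and -6; finiteness at `t ± 15e` therefore spreads to `t +
24e`. For monotonicity, a pair of 2×2 matrices yields `f (t + 6e) + 4 f (t - 6e) ≤ 5 f t`. A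
supremum argument then carries finiteness across the whole interior. The same scalar inequality
excludes jumps, so an operator monotone function that is real on an open set is continuous there.

For sufficiency, enclose the spectra in `[α, β] ⊆ J`, fix an interior point `c` in `(α, β)`, and
replace each operator `X` by `(1 - e)X + ec`, whose spectrum lies in the open interval. The
hypothesis on the interior applies to the contracted operators. As `e → 0`, the integrals converge
to those of `f` with its values at `α` and `β` replaced by one-sided limits; infinite values are
allowed, because the integrands are dominated by their limit plus a constant. This proves the claim
for the modified function.

What remains are the endpoint jumps, that is, multiples of the masses of `{α}` and `{β}`. If `α ≤ A
≤ B ≤ β`, the mass at `α` decreases from `A` to `B` and the mass at `β` increases. This follows from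
operator monotonicity of `1 - (1 + nt)⁻¹` on `[0, ∞)`, whose limit is the indicator of `(0, ∞)`.
Consequently the masses at `α` and `β` of a convex combination are at most those of each operator
combined. The signs of the jumps required at the ends are exactly those for which these atom
inequalities point the right way. -/

/-! ### Scalar spectral measures: support, affine images, atoms at the ends of the spectrum. -/

section SpectralMeasureLemmas

variable {H : Type*} [NormedAddCommGroup H] [InnerProductSpace ℂ H] [CompleteSpace H]

instance regular_scalarSpectralMeasure (A : H →L[ℂ] H) (ρ : NormalPositiveFunctional H) :
    (scalarSpectralMeasure A ρ).Regular := by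
  unfold scalarSpectralMeasure; infer_instance

theorem isCompact_spectrum_real (A : H →L[ℂ] H) : IsCompact (spectrum ℝ A) :=
  spectrum.isCompact A

/-- By inner regularity it suffices to treat compact `K` off the spectrum. A bump function that is 1
on `K` and 0 on the spectrum has zero functional calculus, hence zero integral. -/
theorem scalarSpectralMeasure_compl_spectrum (A : H →L[ℂ] H) (ρ : NormalPositiveFunctional H) :
    scalarSpectralMeasure A ρ (spectrum ℝ A)ᶜ = 0 := by
  have hcl : IsClosed (spectrum ℝ A) := (isCompact_spectrum_real A).isClosed
  rw [hcl.isOpen_compl.measure_eq_iSup_isCompact]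
  simp only [ENNReal.iSup_eq_zero]
  intro K hK hKc
  obtain ⟨g, hg1, hg0, hgc, hg⟩ := exists_continuous_one_zero_of_isCompact hKc hcl
    (disjoint_left.mpr fun x hx h => hK hx h)
  let G : C_c(ℝ, ℝ) := ⟨g, hgc⟩
  have h1 : ∫ t, G t ∂(scalarSpectralMeasure A ρ) = 0 := by
    rw [integral_scalarSpectralMeasure]
    have : cfc (G : ℝ → ℝ) A = cfc (fun _ => (0 : ℝ)) A := cfc_congr fun x hx => hg0 hx
    rw [this]
    simp [cfc_const_zero]
  have h1 := (integral_eq_zero_iff_of_nonneg (f := (G : ℝ → ℝ)) (fun x => (hg x).1)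
    (G.continuous.integrable_of_hasCompactSupport hgc)).mp h1
  refine measure_mono_null ?_ (ae_iff.mp h1)
  intro x hx h
  have := hg1 hx
  simp only [Pi.one_apply] at this
  have h' : g x = 0 := h
  linarith

instance isFiniteMeasure_scalarSpectralMeasure (A : H →L[ℂ] H) (ρ : NormalPositiveFunctional H) :
    IsFiniteMeasure (scalarSpectralMeasure A ρ) := by
  constructor
  rw [← union_compl_self (spectrum ℝ A)]
  refine (measure_union_le _ _).trans_lt ?_
  rw [scalarSpectralMeasure_compl_spectrum, add_zero]
  exact (isCompact_spectrum_real A).measure_lt_top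

theorem ae_mem_spectrum (A : H →L[ℂ] H) (ρ : NormalPositiveFunctional H) :
    ∀ᵐ t ∂(scalarSpectralMeasure A ρ), t ∈ spectrum ℝ A :=
  scalarSpectralMeasure_compl_spectrum A ρ

theorem restrict_scalarSpectralMeasure (A : H →L[ℂ] H) (ρ : NormalPositiveFunctional H) :
    (scalarSpectralMeasure A ρ).restrict (spectrum ℝ A) = scalarSpectralMeasure A ρ :=
  Measure.restrict_eq_self_of_ae_mem (ae_mem_spectrum A ρ)

theorem integral_scalarSpectralMeasure_of_continuous (A : H →L[ℂ] H)
    (ρ : NormalPositiveFunctional H) {g : ℝ → ℝ} (hg : Continuous g) :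
    ∫ t, g t ∂(scalarSpectralMeasure A ρ) = (ρ.toFun (cfc g A)).re := by
  obtain ⟨χ, hχ1, -, hχc, -⟩ := exists_continuous_one_zero_of_isCompact
    (isCompact_spectrum_real A) isClosed_empty (disjoint_empty _)
  let G : C_c(ℝ, ℝ) := ⟨⟨fun x => g x * χ x, by fun_prop⟩, hχc.mul_left⟩
  have hG : ∀ x ∈ spectrum ℝ A, G x = g x := fun x hx => by
    have := hχ1 hx
    simp only [Pi.one_apply] at this
    change g x * χ x = g x
    rw [this, mul_one]
  have h1 : cfc g A = cfc (G : ℝ → ℝ) A := cfc_congr fun x hx => (hG x hx).symm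
  rw [h1, ← integral_scalarSpectralMeasure]
  exact integral_congr_ae ((ae_mem_spectrum A ρ).mono fun x hx => (hG x hx).symm)

theorem scalarSpectralMeasure_univ (A : H →L[ℂ] H) (hA : IsSelfAdjoint A)
    (ρ : NormalPositiveFunctional H) :
    scalarSpectralMeasure A ρ univ = ENNReal.ofReal (ρ.toFun 1).re := by
  have := integral_scalarSpectralMeasure_of_continuous A ρ (g := fun _ => (1 : ℝ))
    continuous_const
  rw [cfc_const_one ℝ A] at this
  rw [← this]
  simp [ofReal_measureReal]

theorem integrable_scalarSpectralMeasure (A : H →L[ℂ] H) (ρ : NormalPositiveFunctional H)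
    {g : ℝ → ℝ} (hg : Continuous g) : Integrable g (scalarSpectralMeasure A ρ) := by
  rw [← restrict_scalarSpectralMeasure]
  exact hg.continuousOn.integrableOn_compact (isCompact_spectrum_real A)

/-- Affine substitution serves three times: to move an endpoint to 0, to exchange the two ends by
reflection, and to contract the spectrum into the interior. -/
theorem scalarSpectralMeasure_affine (A : H →L[ℂ] H) (hA : IsSelfAdjoint A)
    (ρ : NormalPositiveFunctional H) (s c : ℝ) :
    scalarSpectralMeasure (s • A + c • (1 : H →L[ℂ] H)) ρ
      = (scalarSpectralMeasure A ρ).map (fun t => s * t + c) := by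
  have hcont : Continuous (fun t : ℝ => s * t + c) := by fun_prop
  have e : s • A + c • (1 : H →L[ℂ] H) = cfc (fun t : ℝ => s * t + c) A := by
    rw [cfc_add .., cfc_const_mul .., cfc_id' ℝ A, cfc_const c A, Algebra.algebraMap_eq_smul_one]
  refine Measure.ext_of_integral_eq_on_compactlySupported fun g => ?_
  have hg : Continuous (g : ℝ → ℝ) := g.continuous
  rw [integral_scalarSpectralMeasure, integral_map hcont.aemeasurable
    hg.aestronglyMeasurable, integral_scalarSpectralMeasure_of_continuous A ρ
    (g := fun x => g (s * x + c)) (by fun_prop), e]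
  rw [← cfc_comp' (g : ℝ → ℝ) (fun t : ℝ => s * t + c) A (by fun_prop) (by fun_prop)]

theorem re_toFun_mono (ρ : NormalPositiveFunctional H) {X Y : H →L[ℂ] H} (h : X ≤ Y) :
    (ρ.toFun X).re ≤ (ρ.toFun Y).re := by
  have := (Complex.le_def.mp (ρ.nonneg (Y - X) (sub_nonneg.mpr h))).1
  simp only [map_sub, Complex.sub_re, Complex.zero_re] at this
  linarith

theorem spectrum_affine_subset {A : H →L[ℂ] H} (hA : IsSelfAdjoint A) (s c : ℝ) :
    spectrum ℝ (s • A + c • (1 : H →L[ℂ] H)) ⊆ (fun t => s * t + c) '' spectrum ℝ A := by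
  have e : s • A + c • (1 : H →L[ℂ] H) = cfc (fun t : ℝ => s * t + c) A := by
    rw [cfc_add .., cfc_const_mul .., cfc_id' ℝ A, cfc_const c A, Algebra.algebraMap_eq_smul_one]
  rw [e, cfc_map_spectrum (fun t : ℝ => s * t + c) A]

theorem isSelfAdjoint_affine {A : H →L[ℂ] H} (hA : IsSelfAdjoint A) (s c : ℝ) :
    IsSelfAdjoint (s • A + c • (1 : H →L[ℂ] H)) :=
  ((IsSelfAdjoint.all s).smul hA).add ((IsSelfAdjoint.all c).smul (.one _))

theorem tendsto_integral_one_sub_inv (μ : Measure ℝ) [IsFiniteMeasure μ] :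
    Tendsto (fun n : ℕ => ∫ t, (1 - (1 + |(n : ℝ) * t|)⁻¹) ∂μ) atTop (𝓝 (μ.real {0}ᶜ)) := by
  have hlim : μ.real {0}ᶜ = ∫ t, ({0}ᶜ : Set ℝ).indicator (fun _ => (1 : ℝ)) t ∂μ := by
    rw [integral_indicator_const _ (measurableSet_singleton 0).compl]; simp
  rw [hlim]
  refine tendsto_integral_of_dominated_convergence (fun _ => 1) (fun n => ?_)
    (integrable_const _) (fun n => .of_forall fun t => ?_) (.of_forall fun t => ?_)
  · refine Continuous.aestronglyMeasurable ?_
    refine continuous_const.sub (Continuous.inv₀ (by fun_prop) fun t => ?_)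
    positivity
  · have h1 : (1 + |(n : ℝ) * t|)⁻¹ ≤ 1 := inv_le_one_of_one_le₀ (by linarith [abs_nonneg ((n : ℝ) * t)])
    have h2 : 0 < (1 + |(n : ℝ) * t|)⁻¹ := by positivity
    rw [Real.norm_eq_abs, abs_le]
    constructor <;> linarith
  · by_cases ht : t = 0
    · simp [ht]
    · have h1 : Tendsto (fun n : ℕ => 1 + |(n : ℝ) * t|) atTop atTop := by
        refine tendsto_atTop_add_const_left _ _ ?_
        simp only [abs_mul, Nat.abs_cast]
        exact tendsto_natCast_atTop_atTop.atTop_mul_const (abs_pos.mpr ht)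
      have := (tendsto_inv_atTop_zero.comp h1).const_sub (1 : ℝ)
      simpa [ht] using this

/-- The functions `1 - (1 + nt)⁻¹` are operator monotone on `[0, ∞)` and tend to the indicator of
`(0, ∞)`, so the mass off 0 grows with the operator. Both total masses equal `ρ(1)`; take
complements. -/
theorem scalarSpectralMeasure_singleton_zero_anti {A B : H →L[ℂ] H} (hA : 0 ≤ A) (hAB : A ≤ B)
    (ρ : NormalPositiveFunctional H) :
    (scalarSpectralMeasure B ρ).real {0} ≤ (scalarSpectralMeasure A ρ).real {0} := by
  have key : ∀ X : H →L[ℂ] H, 0 ≤ X → ∀ n : ℕ,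
      ∫ t, (1 - (1 + |(n : ℝ) * t|)⁻¹) ∂(scalarSpectralMeasure X ρ)
        = (ρ.toFun (cfcₙ (fun x : ℝ => 1 - (1 + x)⁻¹) ((n : ℝ) • X))).re := by
    intro X hX n
    have hXs : IsSelfAdjoint X := .of_nonneg hX
    have hn : 0 ≤ (n : ℝ) • X := smul_nonneg (by positivity) hX
    -- The absolute value makes the integrand continuous on all of ℝ and changes nothing on the
    -- nonnegative spectrum.
    have hc : Continuous (fun x : ℝ => 1 - (1 + |x|)⁻¹) := by
      refine continuous_const.sub (Continuous.inv₀ (by fun_prop) fun t => ?_)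
      positivity
    have e := scalarSpectralMeasure_affine X hXs ρ n 0
    rw [zero_smul, add_zero] at e
    have e1 : ∫ t, (1 - (1 + |(n : ℝ) * t|)⁻¹) ∂(scalarSpectralMeasure X ρ)
        = ∫ t, (1 - (1 + |t|)⁻¹) ∂(scalarSpectralMeasure ((n : ℝ) • X) ρ) := by
      rw [e, integral_map (by fun_prop) hc.aestronglyMeasurable]
      simp
    rw [e1, integral_scalarSpectralMeasure_of_continuous _ ρ hc]
    congr 2
    have hsp : ∀ x ∈ spectrum ℝ ((n : ℝ) • X), 0 ≤ x := fun x hx => spectrum_nonneg_of_nonneg hn hx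
    have hco : ContinuousOn (fun x : ℝ => 1 - (1 + x)⁻¹) (quasispectrum ℝ ((n : ℝ) • X)) := by
      refine continuousOn_const.sub (ContinuousOn.inv₀ (by fun_prop) fun x hx => ?_)
      have := quasispectrum_nonneg_of_nonneg _ hn x hx
      positivity
    rw [cfcₙ_eq_cfc (hf := hco)]
    exact cfc_congr fun x hx => by simp [abs_of_nonneg (hsp x hx)]
  have hB : 0 ≤ B := hA.trans hAB
  have hle : (scalarSpectralMeasure A ρ).real {0}ᶜ ≤ (scalarSpectralMeasure B ρ).real {0}ᶜ := by
    refine le_of_tendsto_of_tendsto' (tendsto_integral_one_sub_inv _)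
      (tendsto_integral_one_sub_inv _) fun n => ?_
    rw [key A hA, key B hB]
    refine re_toFun_mono ρ (CFC.monotoneOn_one_sub_one_add_inv_real ?_ ?_ ?_)
    · exact smul_nonneg (by positivity) hA
    · exact smul_nonneg (by positivity) hB
    · exact smul_le_smul_of_nonneg_left hAB (by positivity)
  rw [measureReal_compl (measurableSet_singleton 0), measureReal_compl (measurableSet_singleton 0),
    measureReal_def _ univ, measureReal_def _ univ,
    scalarSpectralMeasure_univ A (.of_nonneg hA), scalarSpectralMeasure_univ B (.of_nonneg hB)] at hle
  linarith

theorem scalarSpectralMeasure_affine_singleton {A : H →L[ℂ] H} (hA : IsSelfAdjoint A)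
    (ρ : NormalPositiveFunctional H) {s : ℝ} (hs : s ≠ 0) (c t : ℝ) :
    scalarSpectralMeasure (s • A + c • (1 : H →L[ℂ] H)) ρ {s * t + c}
      = scalarSpectralMeasure A ρ {t} := by
  rw [scalarSpectralMeasure_affine A hA, Measure.map_apply (by fun_prop)
    (measurableSet_singleton _)]
  congr 1
  ext x
  simp [hs]

theorem smul_one_le_iff_spectrum {A : H →L[ℂ] H} (hA : IsSelfAdjoint A) (α : ℝ) :
    α • (1 : H →L[ℂ] H) ≤ A ↔ ∀ x ∈ spectrum ℝ A, α ≤ x := by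
  rw [← Algebra.algebraMap_eq_smul_one, algebraMap_le_iff_le_spectrum]

theorem le_smul_one_iff_spectrum {A : H →L[ℂ] H} (hA : IsSelfAdjoint A) (β : ℝ) :
    A ≤ β • (1 : H →L[ℂ] H) ↔ ∀ x ∈ spectrum ℝ A, x ≤ β := by
  rw [← Algebra.algebraMap_eq_smul_one, le_algebraMap_iff_spectrum_le]

theorem scalarSpectralMeasure_singleton_anti {A B : H →L[ℂ] H} (hA : IsSelfAdjoint A)
    (hB : IsSelfAdjoint B) {α : ℝ} (hα : α • (1 : H →L[ℂ] H) ≤ A) (hAB : A ≤ B)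
    (ρ : NormalPositiveFunctional H) :
    scalarSpectralMeasure B ρ {α} ≤ scalarSpectralMeasure A ρ {α} := by
  have h := scalarSpectralMeasure_singleton_zero_anti (A := (1 : ℝ) • A + (-α) • 1)
    (B := (1 : ℝ) • B + (-α) • 1) (by simpa [← sub_eq_add_neg] using hα) (by simpa using hAB) ρ
  have h1 := scalarSpectralMeasure_affine_singleton hA ρ one_ne_zero (-α) α
  have h2 := scalarSpectralMeasure_affine_singleton hB ρ one_ne_zero (-α) α
  rw [show (1 : ℝ) * α + -α = 0 by ring] at h1 h2
  rw [measureReal_def, measureReal_def, h1, h2] at h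
  exact (ENNReal.toReal_le_toReal (measure_ne_top _ _) (measure_ne_top _ _)).mp h

theorem scalarSpectralMeasure_singleton_mono {A B : H →L[ℂ] H} (hA : IsSelfAdjoint A)
    (hB : IsSelfAdjoint B) {β : ℝ} (hβ : B ≤ β • (1 : H →L[ℂ] H)) (hAB : A ≤ B)
    (ρ : NormalPositiveFunctional H) :
    scalarSpectralMeasure A ρ {β} ≤ scalarSpectralMeasure B ρ {β} := by
  have h := scalarSpectralMeasure_singleton_anti (A := (-1 : ℝ) • B + (0 : ℝ) • 1)
    (B := (-1 : ℝ) • A + (0 : ℝ) • 1) (isSelfAdjoint_affine hB _ _) (isSelfAdjoint_affine hA _ _)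
    (α := -β) (by simpa using hβ) (by simpa using hAB) ρ
  have h1 := scalarSpectralMeasure_affine_singleton hA ρ (s := -1) (by norm_num) 0 β
  have h2 := scalarSpectralMeasure_affine_singleton hB ρ (s := -1) (by norm_num) 0 β
  rw [show (-1 : ℝ) * β + 0 = -β by ring] at h1 h2
  rwa [h1, h2] at h

/-- This is `(x + M)⁺ + x⁻ = x⁺ + M`, arranged without subtraction so that it can be integrated in
`ℝ≥0∞`. -/
theorem EReal.toENNReal_add_real {x : EReal} {M : ℝ} (hM : 0 ≤ M) (hx : ((-M : ℝ) : EReal) ≤ x) :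
    (x + (M : EReal)).toENNReal + (-x).toENNReal = x.toENNReal + ENNReal.ofReal M := by
  induction x with
  | bot => simp at hx
  | top => simp
  | coe r =>
    have hr : -M ≤ r := by exact_mod_cast hx
    rw [← EReal.coe_add, ← EReal.coe_neg]
    simp only [EReal.toENNReal_of_ne_top (EReal.coe_ne_top _), EReal.toReal_coe]
    rcases le_total 0 r with h | h
    · rw [ENNReal.ofReal_eq_zero.mpr (by linarith : -r ≤ 0), add_zero, ENNReal.ofReal_add h hM]
    · rw [ENNReal.ofReal_eq_zero.mpr h, zero_add, ← ENNReal.ofReal_add (by linarith) (by linarith)]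
      congr 1; ring

/-- Shifting by a constant turns `f(A)(ρ)` into a single Lebesgue integral. -/
theorem extApply_add_const {f : ℝ → EReal} {A : H →L[ℂ] H} (hA : IsSelfAdjoint A)
    (ρ : NormalPositiveFunctional H) {M : ℝ} (hM : 0 ≤ M)
    (hf : ∀ t ∈ spectrum ℝ A, ((-M : ℝ) : EReal) ≤ f t)
    (hmeas : Measurable fun t : spectrum ℝ A => f t) :
    extApply f A ρ + ((M * (ρ.toFun 1).re : ℝ) : EReal)
      = ((∫⁻ t in spectrum ℝ A, (f t + (M : EReal)).toENNReal ∂(scalarSpectralMeasure A ρ) : ℝ≥0∞) :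
        EReal) := by
  have hms : MeasurableSet (spectrum ℝ A) := (isCompact_spectrum_real A).measurableSet
  set μ := (scalarSpectralMeasure A ρ).restrict (spectrum ℝ A) with hμ
  have hae : ∀ᵐ t ∂μ, t ∈ spectrum ℝ A := ae_restrict_mem hms
  have hfm : AEMeasurable f μ :=
    aemeasurable_restrict_of_measurable_subtype hms hmeas
  have hfn : AEMeasurable (fun t => (-(f t)).toENNReal) μ := hfm.neg.ereal_toENNReal
  have hm0 : 0 ≤ (ρ.toFun 1).re := by simpa using re_toFun_mono ρ (zero_le_one (α := H →L[ℂ] H))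
  have hμu : μ univ = ENNReal.ofReal (ρ.toFun 1).re := by
    rw [hμ, restrict_scalarSpectralMeasure, scalarSpectralMeasure_univ A hA]
  have hneg : ∫⁻ t, (-(f t)).toENNReal ∂μ ≠ ⊤ := by
    refine ne_top_of_le_ne_top (b := ∫⁻ _, ENNReal.ofReal M ∂μ) ?_ (lintegral_mono_ae ?_)
    · rw [lintegral_const, hμu]; exact ENNReal.mul_ne_top (by simp) (by simp)
    · filter_upwards [hae] with t ht
      have := hf t ht
      have h2 : -(f t) ≤ (M : EReal) := by
        rw [EReal.neg_le]; simpa using this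
      exact (EReal.toENNReal_le_toENNReal h2).trans (by simp [EReal.toENNReal_of_ne_top])
  have hsum : ∫⁻ t, (f t + (M : EReal)).toENNReal ∂μ + ∫⁻ t, (-(f t)).toENNReal ∂μ
      = ∫⁻ t, (f t).toENNReal ∂μ + ENNReal.ofReal (M * (ρ.toFun 1).re) := by
    rw [← lintegral_add_right' _ hfn, ENNReal.ofReal_mul hM, ← hμu, ← lintegral_const,
      ← lintegral_add_right _ measurable_const]
    refine lintegral_congr_ae ?_
    filter_upwards [hae] with t ht
    exact EReal.toENNReal_add_real hM (hf t ht)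
  unfold extApply
  rw [← hμ]
  generalize ∫⁻ t, (f t + (M : EReal)).toENNReal ∂μ = a at *
  generalize ∫⁻ t, (f t).toENNReal ∂μ = b at *
  generalize ∫⁻ t, (-(f t)).toENNReal ∂μ = c at *
  have hK : 0 ≤ M * (ρ.toFun 1).re := mul_nonneg hM hm0
  generalize M * (ρ.toFun 1).re = K at *
  lift c to NNReal using hneg
  have := congrArg ((↑) : ℝ≥0∞ → EReal) hsum
  rw [EReal.coe_ennreal_add, EReal.coe_ennreal_add, EReal.coe_ennreal_ofReal, max_eq_left hK] at this
  have hc : ((c : ℝ≥0∞) : EReal) = ((c : ℝ) : EReal) := rfl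
  rw [hc] at this ⊢
  rw [sub_eq_add_neg, add_assoc, add_comm (-((c : ℝ) : EReal)), ← add_assoc, ← this, add_assoc,
    ← sub_eq_add_neg, ← EReal.coe_sub]
  simp

end SpectralMeasureLemmas

/-! ### Vector functionals in finite dimension. -/

section VectorState

variable {H : Type*} [NormedAddCommGroup H] [InnerProductSpace ℂ H] [CompleteSpace H]

omit [CompleteSpace H] in
theorem inner_apply_nonneg {X : H →L[ℂ] H} (hX : 0 ≤ X) (v : H) : 0 ≤ inner ℂ v (X v) :=
  ((ContinuousLinearMap.nonneg_iff_isPositive X).mp hX).inner_nonneg_right v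

theorem re_inner_apply_mono {X Y : H →L[ℂ] H} (h : X ≤ Y) (v : H) :
    (inner ℂ v (X v)).re ≤ (inner ℂ v (Y v)).re := by
  have := (Complex.le_def.mp (inner_apply_nonneg (sub_nonneg.mpr h) v)).1
  simp only [sub_apply, inner_sub_right, Complex.sub_re, Complex.zero_re] at this
  linarith

theorem isCompact_Icc_operator [FiniteDimensional ℂ H] (S T : H →L[ℂ] H) :
    IsCompact (Icc S T) := by
  have : ProperSpace (H →L[ℂ] H) := FiniteDimensional.proper ℂ _
  refine Metric.isCompact_of_isClosed_isBounded isClosed_Icc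
    (isBounded_iff_forall_norm_le.mpr ⟨‖T - S‖ + ‖S‖, fun Y hY => ?_⟩)
  have h1 : ‖Y - S‖ ≤ ‖T - S‖ := CStarAlgebra.norm_le_norm_of_nonneg_of_le
    (sub_nonneg.mpr hY.1) (sub_le_sub_right hY.2 S)
  calc ‖Y‖ = ‖(Y - S) + S‖ := by simp
    _ ≤ _ := (norm_add_le _ _).trans (by gcongr)

/-- In finite dimension every vector functional `X ↦ ⟪v, X v⟫` is normal. -/
noncomputable def vectorFunctional [FiniteDimensional ℂ H] (v : H) : NormalPositiveFunctional H where
  toFun :=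
    { toFun := fun X => inner ℂ v (X v)
      map_add' := fun X Y => by simp
      map_smul' := fun c X => by simp }
  nonneg X hX := inner_apply_nonneg hX v
  normal S X hne _ hdir hlub := by
    refine ⟨?_, fun c hc => ?_⟩
    · rintro _ ⟨T, hT, rfl⟩
      exact re_inner_apply_mono (hlub.1 hT) v
    · have hcont : Continuous fun Y : H →L[ℂ] H => (inner ℂ v (Y v)).re := by fun_prop
      let t : S → Set (H →L[ℂ] H) := fun T => Icc T.1 X ∩ {Y | (inner ℂ v (Y v)).re ≤ c}
      have hcl : IsClosed {Y : H →L[ℂ] H | (inner ℂ v (Y v)).re ≤ c} :=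
        isClosed_le hcont continuous_const
      have : Nonempty S := hne.to_subtype
      -- Order intervals are compact in finite dimension, so some `Y` lies above all of `S` and
      -- still has value at most `c`. As `X` is the least upper bound, `X ≤ Y`.
      obtain ⟨Y, hY⟩ := IsCompact.nonempty_iInter_of_directed_nonempty_isCompact_isClosed t
        (fun T₁ T₂ => by
          obtain ⟨T, hT, h1, h2⟩ := hdir T₁.1 T₁.2 T₂.1 T₂.2
          exact ⟨⟨T, hT⟩, inter_subset_inter_left _ (Icc_subset_Icc_left h1),
            inter_subset_inter_left _ (Icc_subset_Icc_left h2)⟩)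
        (fun T => ⟨T.1, ⟨le_rfl, hlub.1 T.2⟩, hc ⟨T.1, T.2, rfl⟩⟩)
        (fun T => (isCompact_Icc_operator _ _).inter_right hcl)
        (fun T => isClosed_Icc.inter hcl)
      rw [mem_iInter] at hY
      have hXY : X ≤ Y := hlub.2 fun T hT => (hY ⟨T, hT⟩).1.1
      obtain ⟨T, hT⟩ := hne
      exact (re_inner_apply_mono hXY v).trans (hY ⟨T, hT⟩).2

@[simp] theorem vectorFunctional_apply [FiniteDimensional ℂ H] (v : H) (X : H →L[ℂ] H) :
    (vectorFunctional v).toFun X = inner ℂ v (X v) := rfl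

theorem re_inner_mul_self_apply {X : H →L[ℂ] H} (hX : IsSelfAdjoint X) (v : H) :
    (inner ℂ v ((X * X) v)).re = ‖X v‖ ^ 2 := by
  have : inner ℂ v ((X * X) v) = inner ℂ (X v) (X v) := by
    rw [mul_apply_eq_comp, ← ContinuousLinearMap.adjoint_inner_left, hX.adjoint_eq]
  rw [this, inner_self_eq_norm_sq_to_K]
  norm_cast

theorem norm_cfc_apply_sq [FiniteDimensional ℂ H] (A : H →L[ℂ] H) {g : ℝ → ℝ} (hg : Continuous g)
    (v : H) :
    ∫ s, g s * g s ∂(scalarSpectralMeasure A (vectorFunctional v)) = ‖cfc g A v‖ ^ 2 := by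
  rw [integral_scalarSpectralMeasure_of_continuous _ _ (by fun_prop), vectorFunctional_apply,
    cfc_mul g g A, re_inner_mul_self_apply (cfc_predicate g A)]

theorem cfc_sub_const_apply {A : H →L[ℂ] H} (hA : IsSelfAdjoint A) {g : ℝ → ℝ} (hg : Continuous g)
    (c : ℝ) (v : H) : cfc (fun s => g s - c) A v = cfc g A v - (c : ℂ) • v := by
  rw [cfc_sub .., cfc_const c A, Algebra.algebraMap_eq_smul_one]
  simp

/-- A zero-variance argument: `∫ (s - t)² dμ = ‖(A - t)v‖² = 0` concentrates `μ` at `t`, whence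
`‖g(A)v - g(t)v‖² = ∫ (g - g(t))² dμ = 0`. -/
theorem cfc_apply_eigenvector [FiniteDimensional ℂ H] {A : H →L[ℂ] H} (hA : IsSelfAdjoint A)
    {v : H} {t : ℝ} (hv : A v = (t : ℂ) • v) {g : ℝ → ℝ} (hg : Continuous g) :
    cfc g A v = (g t : ℂ) • v := by
  set μ := scalarSpectralMeasure A (vectorFunctional v)
  have h0 : ∫ s, (s - t) * (s - t) ∂μ = 0 := by
    rw [norm_cfc_apply_sq A (g := fun s => s - t) (by fun_prop), cfc_sub_const_apply hA
      (g := fun s => s) (by fun_prop), cfc_id' ℝ A, hv]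
    simp
  rw [integral_eq_zero_iff_of_nonneg (fun s => mul_self_nonneg _)
    (integrable_scalarSpectralMeasure A _ (g := fun s => (s - t) * (s - t)) (by fun_prop))] at h0
  have h1 : ∫ s, (g s - g t) * (g s - g t) ∂μ = 0 := by
    refine integral_eq_zero_of_ae ?_
    filter_upwards [h0] with s hs
    have : s = t := by simpa [sub_eq_zero] using hs
    simp [this]
  rw [norm_cfc_apply_sq A (g := fun s => g s - g t) (by fun_prop), cfc_sub_const_apply hA hg] at h1
  exact sub_eq_zero.mp (by simpa using h1)

theorem scalarSpectralMeasure_vectorFunctional [FiniteDimensional ℂ H] {A : H →L[ℂ] H}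
    (hA : IsSelfAdjoint A) {v w : H} {t s : ℝ} (hv : A v = (t : ℂ) • v) (hw : A w = (s : ℂ) • w)
    (hvw : inner ℂ v w = 0) :
    scalarSpectralMeasure A (vectorFunctional (v + w))
      = ENNReal.ofReal (‖v‖ ^ 2) • Measure.dirac t + ENNReal.ofReal (‖w‖ ^ 2) • Measure.dirac s := by
  have hfin : ∀ (a x : ℝ), IsFiniteMeasure (ENNReal.ofReal a • Measure.dirac x) := fun a x =>
    Measure.smul_finite _ ENNReal.ofReal_ne_top
  have hwv : inner ℂ w v = 0 := by rw [← inner_conj_symm, hvw, map_zero]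
  refine Measure.ext_of_integral_eq_on_compactlySupported fun g => ?_
  have hg : Continuous (g : ℝ → ℝ) := g.continuous
  have hint : ∀ (a x : ℝ), Integrable (g : ℝ → ℝ) (ENNReal.ofReal a • Measure.dirac x) := fun a x =>
    (integrable_dirac (by simp)).smul_measure ENNReal.ofReal_ne_top
  rw [integral_scalarSpectralMeasure, vectorFunctional_apply, map_add,
    cfc_apply_eigenvector hA hv hg, cfc_apply_eigenvector hA hw hg,
    integral_add_measure (hint _ _) (hint _ _), integral_smul_measure, integral_smul_measure,
    integral_dirac, integral_dirac, ENNReal.toReal_ofReal (by positivity),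
    ENNReal.toReal_ofReal (by positivity)]
  simp only [inner_add_left, inner_add_right, inner_smul_right, hvw, hwv,
    inner_self_eq_norm_sq_to_K]
  simp [← Complex.ofReal_pow, mul_comm]

theorem EReal.coe_toENNReal_sub_of_ne_bot {x : EReal} (hx : x ≠ ⊥) :
    ((x.toENNReal : ℝ≥0∞) : EReal) - (((-x).toENNReal : ℝ≥0∞) : EReal) = x := by
  have h : (-x).toENNReal ≠ ⊤ := by simp [hx]
  induction x with
  | bot => exact absurd rfl hx
  | top => simp
  | coe r =>
    rw [← EReal.coe_neg]
    simp only [EReal.toENNReal_of_ne_top (EReal.coe_ne_top _), EReal.toReal_coe,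
      EReal.coe_ennreal_ofReal]
    rw [← EReal.coe_sub]
    norm_cast
    rcases le_total 0 r with h | h
    · rw [max_eq_left h, max_eq_right (by linarith)]; ring
    · rw [max_eq_right h, max_eq_left (by linarith)]; ring

theorem extApply_vectorFunctional [FiniteDimensional ℂ H] {A : H →L[ℂ] H}
    (hA : IsSelfAdjoint A) {v w : H} {t s : ℝ} (hv : A v = (t : ℂ) • v) (hw : A w = (s : ℂ) • w)
    (hvw : inner ℂ v w = 0) {f : ℝ → EReal} (ht : f t ≠ ⊥) (hs : f s ≠ ⊥) :
    extApply f A (vectorFunctional (v + w))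
      = ((‖v‖ ^ 2 : ℝ) : EReal) * f t + ((‖w‖ ^ 2 : ℝ) : EReal) * f s := by
  have hp : (0 : EReal) ≤ ((‖v‖ ^ 2 : ℝ) : EReal) := by exact_mod_cast sq_nonneg ‖v‖
  have hq : (0 : EReal) ≤ ((‖w‖ ^ 2 : ℝ) : EReal) := by exact_mod_cast sq_nonneg ‖w‖
  unfold extApply
  rw [restrict_scalarSpectralMeasure, scalarSpectralMeasure_vectorFunctional hA hv hw hvw]
  simp only [lintegral_add_measure, lintegral_smul_measure, lintegral_dirac, smul_eq_mul,
    EReal.coe_ennreal_add, EReal.coe_ennreal_mul]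
  rw [EReal.coe_ennreal_ofReal, max_eq_left (by positivity), EReal.coe_ennreal_ofReal,
    max_eq_left (by positivity)]
  have h1 : (-(f t)).toENNReal ≠ ⊤ := by simp [ht]
  have h2 : (-(f s)).toENNReal ≠ ⊤ := by simp [hs]
  conv_rhs => rw [← EReal.coe_toENNReal_sub_of_ne_bot ht, ← EReal.coe_toENNReal_sub_of_ne_bot hs]
  lift (-(f t)).toENNReal to NNReal using h1 with a
  lift (-(f s)).toENNReal to NNReal using h2 with b
  have ha : ((a : ℝ≥0∞) : EReal) = ((a : ℝ) : EReal) := rfl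
  have hb : ((b : ℝ≥0∞) : EReal) = ((b : ℝ) : EReal) := rfl
  rw [ha, hb]
  generalize (f t).toENNReal = x
  generalize (f s).toENNReal = y
  have key : ∀ (p : ℝ) (_ : (0 : EReal) ≤ p) (x : ℝ≥0∞) (a : ℝ), ((p : ℝ) : EReal) * ((x : EReal) - (a : EReal))
      = (p : EReal) * (x : EReal) - (((p * a : ℝ)) : EReal) := by
    intro p hp x a
    rw [sub_eq_add_neg, EReal.left_distrib_of_nonneg_of_ne_top hp (EReal.coe_ne_top _),
      ← EReal.coe_neg, ← EReal.coe_mul, sub_eq_add_neg, ← EReal.coe_neg, mul_neg]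
  rw [key _ hp, key _ hq, ← EReal.coe_mul, ← EReal.coe_mul, ← EReal.coe_add, sub_eq_add_neg, sub_eq_add_neg,
    sub_eq_add_neg, ← EReal.coe_neg, ← EReal.coe_neg, ← EReal.coe_neg, add_add_add_comm,
    ← EReal.coe_add]
  congr 2
  ring

end VectorState

/-! ### Real symmetric matrices as operators on complex Euclidean space. -/

section RealMatrices

open Matrix

/-- `ℂⁿ` with its Euclidean norm, in an arbitrary universe. As a separate type it carries a single
action of `ℝ`, the one induced by the complex structure. -/
def ComplexEuclidean (n : ℕ) : Type u := EuclideanSpace ℂ (ULift.{u} (Fin n))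

noncomputable instance (n : ℕ) : NormedAddCommGroup (ComplexEuclidean.{u} n) :=
  inferInstanceAs (NormedAddCommGroup (EuclideanSpace ℂ (ULift.{u} (Fin n))))

noncomputable instance (n : ℕ) : InnerProductSpace ℂ (ComplexEuclidean.{u} n) :=
  inferInstanceAs (InnerProductSpace ℂ (EuclideanSpace ℂ (ULift.{u} (Fin n))))

instance (n : ℕ) : CompleteSpace (ComplexEuclidean.{u} n) :=
  inferInstanceAs (CompleteSpace (EuclideanSpace ℂ (ULift.{u} (Fin n))))

instance (n : ℕ) : FiniteDimensional ℂ (ComplexEuclidean.{u} n) :=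
  inferInstanceAs (FiniteDimensional ℂ (EuclideanSpace ℂ (ULift.{u} (Fin n))))

/-- Matrices act on `ℂⁿ`. -/
noncomputable def matrixStarAlgEquiv (n : ℕ) :
    Matrix (ULift.{u} (Fin n)) (ULift.{u} (Fin n)) ℂ ≃⋆ₐ[ℂ]
      (ComplexEuclidean.{u} n →L[ℂ] ComplexEuclidean.{u} n) :=
  Matrix.toEuclideanCLM (n := ULift.{u} (Fin n)) (𝕜 := ℂ)

/-- The vector of `ℂⁿ` with given real coordinates, in an arbitrary universe. -/
noncomputable def realVector {n : ℕ} (x : Fin n → ℝ) : ComplexEuclidean.{u} n :=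
  WithLp.toLp 2 fun i => (x i.down : ℂ)

/-- The operator on `ℂⁿ` given by a real matrix. -/
noncomputable def realMatrixOp {n : ℕ} (m : Matrix (Fin n) (Fin n) ℝ) :
    ComplexEuclidean.{u} n →L[ℂ] ComplexEuclidean.{u} n :=
  matrixStarAlgEquiv n
    (Matrix.of fun i j => (m i.down j.down : ℂ))

theorem realMatrixOp_realVector {n : ℕ} (m : Matrix (Fin n) (Fin n) ℝ) (x : Fin n → ℝ) :
    realMatrixOp.{u} m (realVector x) = realVector (m *ᵥ x) := by
  refine (Matrix.toEuclideanCLM_toLp (𝕜 := ℂ) _ _).trans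
    (congrArg (WithLp.toLp 2) (funext fun i => ?_))
  simp only [Matrix.mulVec, dotProduct, Matrix.of_apply, Complex.ofReal_sum, Complex.ofReal_mul]
  exact Fintype.sum_equiv Equiv.ulift _ _ fun _ => rfl

theorem realVector_add {n : ℕ} (x y : Fin n → ℝ) :
    realVector.{u} (x + y) = realVector x + realVector y := by
  exact (congrArg (WithLp.toLp 2) (funext fun i => by simp)).trans (WithLp.toLp_add 2 _ _)

theorem realVector_smul {n : ℕ} (a : ℝ) (x : Fin n → ℝ) :
    realVector.{u} (a • x) = (a : ℂ) • realVector x := by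
  exact (congrArg (WithLp.toLp 2) (funext fun i => by simp)).trans
    (WithLp.toLp_smul 2 (a : ℂ) fun i : ULift.{u} (Fin n) => (x i.down : ℂ))

theorem inner_realVector {n : ℕ} (x y : Fin n → ℝ) :
    inner ℂ (realVector.{u} x) (realVector y) = ((x ⬝ᵥ y : ℝ) : ℂ) := by
  refine (PiLp.inner_apply _ _).trans ?_
  simp only [realVector, dotProduct, Complex.ofReal_sum]
  refine Fintype.sum_equiv Equiv.ulift _ _ fun i => ?_
  simp [mul_comm]

theorem norm_realVector_sq {n : ℕ} (x : Fin n → ℝ) :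
    ‖realVector.{u} x‖ ^ 2 = x ⬝ᵥ x := by
  have h := congrArg Complex.re (inner_realVector.{u} x x)
  rw [Complex.ofReal_re] at h
  rw [← h, inner_self_eq_norm_sq_to_K]
  norm_cast

theorem isSelfAdjoint_realMatrixOp {n : ℕ} {m : Matrix (Fin n) (Fin n) ℝ} (hm : m.IsSymm) :
    IsSelfAdjoint (realMatrixOp.{u} m) := by
  unfold realMatrixOp
  refine IsSelfAdjoint.map ?_ _
  ext i j
  simp [Matrix.star_apply, ← hm.apply i.down j.down]

theorem realMatrixOp_add {n : ℕ} (l m : Matrix (Fin n) (Fin n) ℝ) :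
    realMatrixOp.{u} (l + m) = realMatrixOp l + realMatrixOp m := by
  unfold realMatrixOp
  rw [← map_add]; congr 1; ext i j; simp

theorem realMatrixOp_smul {n : ℕ} (a : ℝ) (m : Matrix (Fin n) (Fin n) ℝ) :
    realMatrixOp.{u} (a • m) = a • realMatrixOp m := by
  unfold realMatrixOp
  rw [← Complex.coe_smul, ← map_smul]
  congr 1; ext i j; simp

theorem realMatrixOp_transpose_mul_self_nonneg {n : ℕ} (l : Matrix (Fin n) (Fin n) ℝ) :
    0 ≤ realMatrixOp.{u} (lᵀ * l) := by
  have : realMatrixOp.{u} (lᵀ * l) = star (realMatrixOp l) * realMatrixOp l := by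
    unfold realMatrixOp
    rw [← map_star, ← map_mul]; congr 1; ext i j
    simp only [Matrix.of_apply, Matrix.mul_apply, Matrix.transpose_apply, Matrix.star_apply,
      Complex.ofReal_sum, Complex.ofReal_mul]
    exact (Fintype.sum_equiv Equiv.ulift _ _ fun k => by simp).symm
  rw [this]
  exact star_mul_self_nonneg _

theorem spectrum_realMatrixOp_affine_subset {n : ℕ} {m : Matrix (Fin n) (Fin n) ℝ} (hm : m.IsSymm)
    {K : ℝ} (hK : ‖realMatrixOp.{u} m‖ ≤ K) (e t : ℝ) :
    spectrum ℝ (e • realMatrixOp.{u} m + t • 1) ⊆ Icc (t - K * |e|) (t + K * |e|) := by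
  refine (spectrum_affine_subset (isSelfAdjoint_realMatrixOp hm) e t).trans ?_
  rintro _ ⟨x, hx, rfl⟩
  have h1 : |x| ≤ K := by
    have h := spectrum.norm_le_norm_mul_of_mem hx
    refine le_trans ?_ hK
    rw [Real.norm_eq_abs] at h
    exact h.trans (mul_le_of_le_one_right (norm_nonneg _) ContinuousLinearMap.norm_id_le)
  have h2 : |e * x| ≤ K * |e| := by
    rw [abs_mul, mul_comm]; gcongr
  have := abs_le.mp h2
  constructor <;> simp only <;> linarith

/-- Eigenvalues other than those of `x` and `y` carry no weight, so nothing is asked of `f` there.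
This lets the test matrices have spectrum at points where `f` may be infinite. -/
theorem extApply_realMatrixOp {n : ℕ} {m : Matrix (Fin n) (Fin n) ℝ} (hm : m.IsSymm)
    {x y : Fin n → ℝ} {a b : ℝ} (hx : m *ᵥ x = a • x) (hy : m *ᵥ y = b • y) (hxy : x ⬝ᵥ y = 0)
    {f : ℝ → EReal} {e t : ℝ} (ha : f (e * a + t) ≠ ⊥) (hb : f (e * b + t) ≠ ⊥) :
    extApply f (e • realMatrixOp.{u} m + t • 1) (vectorFunctional (realVector (x + y)))
      = ((x ⬝ᵥ x : ℝ) : EReal) * f (e * a + t) + ((y ⬝ᵥ y : ℝ) : EReal) * f (e * b + t) := by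
  have key : ∀ {z : Fin n → ℝ} {c : ℝ}, m *ᵥ z = c • z →
      (e • realMatrixOp.{u} m + t • 1 : ComplexEuclidean.{u} n →L[ℂ] ComplexEuclidean.{u} n)
        (realVector z)
        = ((e * c + t : ℝ) : ℂ) • realVector z := by
    intro z c hz
    rw [_root_.add_apply, _root_.smul_apply, _root_.smul_apply,
      realMatrixOp_realVector, hz, realVector_smul, ← Complex.coe_smul, ← Complex.coe_smul]
    push_cast
    rw [add_smul, mul_smul]
    rfl
  rw [realVector_add, extApply_vectorFunctional
    (isSelfAdjoint_affine (isSelfAdjoint_realMatrixOp hm) e t) (key hx) (key hy)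
    (by rw [inner_realVector, hxy]; simp) ha hb, norm_realVector_sq, norm_realVector_sq]

end RealMatrices

/-! ### Scalar inequalities from explicit test matrices. -/

section ScalarConsequences

open Matrix

theorem extApply_scalar {f : ℝ → EReal} {t : ℝ} (ht : f t ≠ ⊥) :
    extApply f (t • (1 : ComplexEuclidean.{u} 1 →L[ℂ] _)) (vectorFunctional (realVector.{u} (fun _ : Fin 1 => 1)))
      = f t := by
  have h := extApply_realMatrixOp.{u} (n := 1) (m := 0) (Matrix.isSymm_zero)
    (x := fun _ => 1) (y := 0) (a := 0) (b := 0) (by simp) (by simp) (by simp) (f := f) (e := 0)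
    (t := t) (by simpa using ht) (by simpa using ht)
  simpa [dotProduct] using h

theorem smul_one_mem_selfAdjointWithSpectrumIn {H : Type*} [NormedAddCommGroup H]
    [InnerProductSpace ℂ H] [CompleteSpace H] {J : Set ℝ} {t : ℝ} (ht : t ∈ J) :
    t • (1 : H →L[ℂ] H) ∈ selfAdjointWithSpectrumIn H J := by
  refine ⟨(IsSelfAdjoint.all t).smul (.one _), fun x hx => ?_⟩
  have h := spectrum_affine_subset (.zero _ : IsSelfAdjoint (0 : H →L[ℂ] H)) 0 t
  rw [smul_zero, zero_add] at h
  obtain ⟨y, -, rfl⟩ := h hx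
  simpa using ht

theorem ExtOperatorConvexOn.scalar {f : ℝ → EReal} {J : Set ℝ} (hJ : J.OrdConnected)
    (hbot : ∀ t ∈ J, f t ≠ ⊥) (hf : ExtOperatorConvexOn.{u} f J) {x y r : ℝ} (hx : x ∈ J)
    (hy : y ∈ J) (h0 : 0 < r) (h1 : r < 1) :
    f ((1 - r) * x + r * y) ≤ ((1 - r : ℝ) : EReal) * f x + (r : EReal) * f y := by
  have h := hf _ _ (smul_one_mem_selfAdjointWithSpectrumIn hx) _
    (smul_one_mem_selfAdjointWithSpectrumIn hy) r h0 h1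
    (vectorFunctional (realVector.{u} (fun _ : Fin 1 => 1)))
  have hz : (1 - r) * x + r * y ∈ J := hJ.convex hx hy (by linarith) h0.le (by ring)
  rwa [smul_smul, smul_smul, ← add_smul, extApply_scalar (hbot _ hx), extApply_scalar (hbot _ hy),
    extApply_scalar (hbot _ hz)] at h

theorem ExtOperatorMonotoneOn.scalar {f : ℝ → EReal} {J : Set ℝ}
    (hbot : ∀ t ∈ J, f t ≠ ⊥) (hf : ExtOperatorMonotoneOn.{u} f J) {x y : ℝ} (hx : x ∈ J)
    (hy : y ∈ J) (hxy : x ≤ y) : f x ≤ f y := by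
  have h := hf _ _ (smul_one_mem_selfAdjointWithSpectrumIn hx) _
    (smul_one_mem_selfAdjointWithSpectrumIn hy)
    (smul_le_smul_of_nonneg_right hxy zero_le_one)
    (vectorFunctional (realVector.{u} (fun _ : Fin 1 => 1)))
  rwa [extApply_scalar (hbot _ hx), extApply_scalar (hbot _ hy)] at h

/-- The vector `(-1, 2)` is in the kernel of `B = A + LᵀL`, while for `A = diag(6, -6)` it puts
weight 1 on 6 and weight 4 on -6. The constant `K` bounds the norms and so keeps the spectra in `J`.
-/
theorem ExtOperatorMonotoneOn.exists_scalar_inequality {f : ℝ → EReal} {J : Set ℝ}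
    (hbot : ∀ t ∈ J, f t ≠ ⊥) (hf : ExtOperatorMonotoneOn.{u} f J) :
    ∃ K : ℝ, 0 < K ∧ ∀ e t : ℝ, 0 ≤ e → Icc (t - K * e) (t + K * e) ⊆ J →
      f (t + 6 * e) + 4 * f (t - 6 * e) ≤ 5 * f t := by
  let A : Matrix (Fin 2) (Fin 2) ℝ := !![6, 0; 0, -6]
  let B : Matrix (Fin 2) (Fin 2) ℝ := !![8, 4; 4, 2]
  let L : Matrix (Fin 2) (Fin 2) ℝ := !![1, 2; 1, 2]
  have hA : A.IsSymm := by ext i j; fin_cases i <;> fin_cases j <;> simp [A]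
  have hB : B.IsSymm := by ext i j; fin_cases i <;> fin_cases j <;> simp [B]
  have hBA : B = A + Lᵀ * L := by
    ext i j
    fin_cases i <;> fin_cases j <;>
      simp [A, B, L, Matrix.mul_apply, Fin.sum_univ_two] <;> norm_num
  have hle : realMatrixOp.{u} A ≤ realMatrixOp B := by
    rw [hBA, realMatrixOp_add]
    exact le_add_of_nonneg_right (realMatrixOp_transpose_mul_self_nonneg L)
  refine ⟨max 6 (max ‖realMatrixOp.{u} A‖ ‖realMatrixOp.{u} B‖), by positivity,
    fun e t he hJ => ?_⟩
  set K := max 6 (max ‖realMatrixOp.{u} A‖ ‖realMatrixOp.{u} B‖) with hK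
  have hK6 : 6 ≤ K := le_max_left _ _
  have hmem : ∀ s : ℝ, |s| ≤ 6 → f (e * s + t) ≠ ⊥ := fun s hs => hbot _ <| hJ <| by
    have := abs_le.mp hs
    constructor <;> nlinarith
  have hJ' : Icc (t - K * |e|) (t + K * |e|) ⊆ J := by rwa [abs_of_nonneg he]
  have h := hf _ (e • realMatrixOp.{u} A + t • 1)
    ⟨isSelfAdjoint_affine (isSelfAdjoint_realMatrixOp hA) e t,
      (spectrum_realMatrixOp_affine_subset hA (by simp [hK]) e t).trans hJ'⟩
    (e • realMatrixOp.{u} B + t • 1)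
    ⟨isSelfAdjoint_affine (isSelfAdjoint_realMatrixOp hB) e t,
      (spectrum_realMatrixOp_affine_subset hB (by simp [hK]) e t).trans hJ'⟩
    (add_le_add_left (smul_le_smul_of_nonneg_left hle he) _)
    (vectorFunctional (realVector (![-1, 0] + ![0, 2])))
  rw [extApply_realMatrixOp hA (x := ![-1, 0]) (y := ![0, 2]) (a := 6) (b := -6)
    (by ext i; fin_cases i <;> simp [A]) (by ext i; fin_cases i <;> simp [A]; norm_num)
    (by simp [dotProduct, Fin.sum_univ_two]) (hmem _ (by norm_num)) (hmem _ (by norm_num)),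
    show (![-1, 0] + ![0, 2] : Fin 2 → ℝ) = ![-1, 2] + 0 by
      ext i; fin_cases i <;> simp,
    extApply_realMatrixOp hB (x := ![-1, 2]) (y := 0) (a := 0) (b := 0)
    (by ext i; fin_cases i <;> norm_num [B, Matrix.mulVec, dotProduct, Fin.sum_univ_two])
    (by simp) (by simp) (hmem _ (by norm_num)) (hmem _ (by norm_num))] at h
  have e1 : e * 6 + t = t + 6 * e := by ring
  have e2 : e * -6 + t = t - 6 * e := by ring
  rw [e1, e2] at h
  simp only [dotProduct, Fin.sum_univ_two, mul_zero, zero_add] at h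
  norm_num at h
  exact h

/-- `A` has eigenvalues 15, -15, 50, and its 50-eigenvector `(0, 3, -4)` is orthogonal to the first
basis vector; that vector has weight 1/2 on each of ±15. `B` is `A` conjugated by `diag(1, 1, -1)`,
so the same holds for `B`. In the midpoint `C` the block `!![0, 12; 12, 18]` has eigenvalues 24 and
-6, with weights 1/5 and 4/5. The point 24 lies outside `[-15, 15]`, which is what ordinary
convexity cannot reach. -/
theorem ExtOperatorConvexOn.exists_finite_of_finite {f : ℝ → EReal} {J : Set ℝ}
    (hbot : ∀ t ∈ J, f t ≠ ⊥) (hf : ExtOperatorConvexOn.{u} f J) :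
    ∃ K : ℝ, 24 ≤ K ∧ ∀ e t : ℝ, Icc (t - K * |e|) (t + K * |e|) ⊆ J →
      f (t + 15 * e) ≠ ⊤ → f (t - 15 * e) ≠ ⊤ → f (t + 24 * e) ≠ ⊤ := by
  let A : Matrix (Fin 3) (Fin 3) ℝ := !![0, 12, 9; 12, 18, -24; 9, -24, 32]
  let B : Matrix (Fin 3) (Fin 3) ℝ := !![0, 12, -9; 12, 18, 24; -9, 24, 32]
  let C : Matrix (Fin 3) (Fin 3) ℝ := !![0, 12, 0; 12, 18, 0; 0, 0, 32]
  have hA : A.IsSymm := by ext i j; fin_cases i <;> fin_cases j <;> simp [A]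
  have hB : B.IsSymm := by ext i j; fin_cases i <;> fin_cases j <;> simp [B]
  have hC : C.IsSymm := by ext i j; fin_cases i <;> fin_cases j <;> simp [C]
  have hAB : A + B = (2 : ℝ) • C := by
    ext i j; fin_cases i <;> fin_cases j <;> simp [A, B, C] <;> norm_num
  refine ⟨max 24 (max ‖realMatrixOp.{u} A‖ ‖realMatrixOp.{u} B‖), le_max_left _ _,
    fun e t hJ h1 h2 h3 => ?_⟩
  set K := max 24 (max ‖realMatrixOp.{u} A‖ ‖realMatrixOp.{u} B‖) with hK
  have hK6 : 24 ≤ K := le_max_left _ _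
  have hmem : ∀ s : ℝ, |s| ≤ 24 → f (e * s + t) ≠ ⊥ := fun s hs => hbot _ <| hJ <| by
    have h : |e * s| ≤ K * |e| := by
      rw [abs_mul, mul_comm]; gcongr; exact hs.trans hK6
    have := abs_le.mp h
    constructor <;> linarith
  have h := hf _ (e • realMatrixOp.{u} A + t • 1)
    ⟨isSelfAdjoint_affine (isSelfAdjoint_realMatrixOp hA) e t,
      (spectrum_realMatrixOp_affine_subset hA (by simp [hK]) e t).trans hJ⟩
    (e • realMatrixOp.{u} B + t • 1)
    ⟨isSelfAdjoint_affine (isSelfAdjoint_realMatrixOp hB) e t,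
      (spectrum_realMatrixOp_affine_subset hB (by simp [hK]) e t).trans hJ⟩
    (1 / 2) (by norm_num) (by norm_num)
    (vectorFunctional (realVector ![1, 0, 0]))
  have hop : (1 - 1 / 2 : ℝ) • (e • realMatrixOp.{u} A + t • 1)
      + (1 / 2 : ℝ) • (e • realMatrixOp.{u} B + t • 1) = e • realMatrixOp.{u} C + t • 1 := by
    have hc : realMatrixOp.{u} A + realMatrixOp B = (2 : ℝ) • realMatrixOp C := by
      rw [← realMatrixOp_add, hAB, realMatrixOp_smul]
    have : realMatrixOp.{u} B = (2 : ℝ) • realMatrixOp C - realMatrixOp A := by rw [← hc]; abel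
    rw [this]
    module
  have eA : extApply f (e • realMatrixOp.{u} A + t • 1) (vectorFunctional (realVector ![1, 0, 0]))
      = ((1 / 2 : ℝ) : EReal) * f (e * 15 + t) + ((1 / 2 : ℝ) : EReal) * f (e * -15 + t) := by
    rw [show (![1, 0, 0] : Fin 3 → ℝ) = ![1 / 2, 2 / 5, 3 / 10] + ![1 / 2, -(2 / 5), -(3 / 10)] by
        ext i; fin_cases i <;> simp <;> norm_num,
      extApply_realMatrixOp hA (a := 15) (b := -15)
      (by ext i; fin_cases i <;>
            simp [A, Matrix.mulVec, dotProduct, Fin.sum_univ_three] <;> norm_num)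
      (by ext i; fin_cases i <;>
            simp [A, Matrix.mulVec, dotProduct, Fin.sum_univ_three] <;> norm_num)
      (by simp [dotProduct, Fin.sum_univ_three]; norm_num)
      (hmem _ (by norm_num)) (hmem _ (by norm_num))]
    congr 3 <;> simp [dotProduct, Fin.sum_univ_three] <;> norm_num
  have eB : extApply f (e • realMatrixOp.{u} B + t • 1) (vectorFunctional (realVector ![1, 0, 0]))
      = ((1 / 2 : ℝ) : EReal) * f (e * 15 + t) + ((1 / 2 : ℝ) : EReal) * f (e * -15 + t) := by
    rw [show (![1, 0, 0] : Fin 3 → ℝ) = ![1 / 2, 2 / 5, -(3 / 10)] + ![1 / 2, -(2 / 5), 3 / 10] by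
        ext i; fin_cases i <;> simp <;> norm_num,
      extApply_realMatrixOp hB (a := 15) (b := -15)
      (by ext i; fin_cases i <;>
            simp [B, Matrix.mulVec, dotProduct, Fin.sum_univ_three] <;> norm_num)
      (by ext i; fin_cases i <;>
            simp [B, Matrix.mulVec, dotProduct, Fin.sum_univ_three] <;> norm_num)
      (by simp [dotProduct, Fin.sum_univ_three]; norm_num)
      (hmem _ (by norm_num)) (hmem _ (by norm_num))]
    congr 3 <;> simp [dotProduct, Fin.sum_univ_three] <;> norm_num
  have eC : extApply f (e • realMatrixOp.{u} C + t • 1) (vectorFunctional (realVector ![1, 0, 0]))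
      = ((1 / 5 : ℝ) : EReal) * f (e * 24 + t) + ((4 / 5 : ℝ) : EReal) * f (e * -6 + t) := by
    rw [show (![1, 0, 0] : Fin 3 → ℝ) = ![1 / 5, 2 / 5, 0] + ![4 / 5, -(2 / 5), 0] by
        ext i; fin_cases i <;> simp <;> norm_num,
      extApply_realMatrixOp hC (a := 24) (b := -6)
      (by ext i; fin_cases i <;>
            simp [C, Matrix.mulVec, dotProduct, Fin.sum_univ_three] <;> norm_num)
      (by ext i; fin_cases i <;>
            simp [C, Matrix.mulVec, dotProduct, Fin.sum_univ_three] <;> norm_num)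
      (by simp [dotProduct, Fin.sum_univ_three]; norm_num)
      (hmem _ (by norm_num)) (hmem _ (by norm_num))]
    congr 3 <;> simp [dotProduct, Fin.sum_univ_three] <;> norm_num
  have b15 := hmem 15 (by norm_num)
  have b15' := hmem (-15) (by norm_num)
  have b6 := hmem (-6) (by norm_num)
  rw [hop, eA, eB, eC] at h
  rw [show e * 15 + t = t + 15 * e by ring] at h b15
  rw [show e * -15 + t = t - 15 * e by ring] at h b15'
  rw [show e * 24 + t = t + 24 * e by ring, h3] at h
  lift f (t + 15 * e) to ℝ using ⟨h1, b15⟩ with p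
  lift f (t - 15 * e) to ℝ using ⟨h2, b15'⟩ with q
  rw [EReal.coe_mul_top_of_pos (by norm_num), EReal.top_add_of_ne_bot] at h
  · rw [top_le_iff] at h
    exact EReal.coe_ne_top _ h
  · rw [EReal.mul_ne_bot]
    refine ⟨by simp, ?_, by simp, ?_⟩
    · right; exact b6
    · left; exact_mod_cast (by norm_num : (0 : ℝ) ≤ 4 / 5)

end ScalarConsequences

/-- Convexity inequality on a set of reals for an extended-valued function. -/
def ExtConvexOn (f : ℝ → EReal) (J : Set ℝ) : Prop :=
  ∀ x ∈ J, ∀ y ∈ J, ∀ r : ℝ, 0 < r → r < 1 →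
    f ((1 - r) * x + r * y) ≤ ((1 - r : ℝ) : EReal) * f x + (r : EReal) * f y

/-! ### Propagation along an interval. -/

section Order

theorem Ioo_subset_interior_of_mem {J : Set ℝ} (hJ : J.OrdConnected) {x y : ℝ} (hx : x ∈ J)
    (hy : y ∈ J) : Ioo x y ⊆ interior J :=
  interior_maximal (Ioo_subset_Icc_self.trans (hJ.out hx hy)) isOpen_Ioo

theorem exists_Icc_subset_of_mem_interior {J : Set ℝ} {t : ℝ} (ht : t ∈ interior J) :
    ∃ δ > 0, Icc (t - δ) (t + δ) ⊆ J := by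
  obtain ⟨δ, hδ, h⟩ := Metric.nhds_basis_closedBall.mem_iff.mp (mem_interior_iff_mem_nhds.mp ht)
  exact ⟨δ, hδ, by rwa [← Real.closedBall_eq_Icc]⟩

/-- An order-connected subset that can always be extended a little to the right exhausts the
interior on the right. -/
theorem mem_of_extension_right {J D : Set ℝ} (hJ : J.OrdConnected) (hD : D.OrdConnected)
    (hDJ : D ⊆ J) {x y : ℝ} (hx : x ∈ D) (hy : y ∈ D) (hxy : x < y) {K : ℝ} (hK : 0 < K)
    (hext : ∀ e t : ℝ, 0 < e → Icc (t - K * e) (t + K * e) ⊆ J →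
      t + 15 * e ∈ D → t - 15 * e ∈ D → t + 24 * e ∈ D)
    {t : ℝ} (ht : t ∈ interior J) (hyt : y ≤ t) : t ∈ D := by
  by_contra htD
  set S := D ∩ Icc y t with hS
  have hyS : y ∈ S := ⟨hy, le_rfl, hyt⟩
  have hbdd : BddAbove S := ⟨t, fun z hz => hz.2.2⟩
  set d := sSup S with hd
  have hyd : y ≤ d := le_csSup hbdd hyS
  have hdt : d ≤ t := csSup_le ⟨y, hyS⟩ fun z hz => hz.2.2
  have hdint : d ∈ interior J := by
    rcases hdt.eq_or_lt with h | h
    · rwa [h]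
    · exact Ioo_subset_interior_of_mem hJ (hDJ hx) (interior_subset ht) ⟨hxy.trans_le hyd, h⟩
  obtain ⟨δ, hδ, hδJ⟩ := exists_Icc_subset_of_mem_interior hdint
  have hbelow : ∀ z, x ≤ z → z < d → z ∈ D := fun z h1 h2 => by
    obtain ⟨s, hs, hzs⟩ := exists_lt_of_lt_csSup ⟨y, hyS⟩ h2
    exact hD.out hx hs.1 ⟨h1, hzs.le⟩
  -- Centre the step at `d - 20e`. The two known points `d - 35e` and `d - 5e` lie in `[x, d)`, the
  -- new point is `d + 4e > d`, and the required neighbourhood stays within `δ` of `d`.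
  set e := min δ (d - x) / (K + 40) with he
  have hm : 0 < min δ (d - x) := lt_min hδ (by linarith)
  have hepos : 0 < e := by positivity
  have he1 : e * (K + 40) = min δ (d - x) := by rw [he]; field_simp
  have he2 : e * (K + 40) ≤ δ := he1 ▸ min_le_left _ _
  have he3 : e * (K + 40) ≤ d - x := he1 ▸ min_le_right _ _
  have hKe : 0 < K * e := by positivity
  have h := hext e (d - 20 * e) hepos
    (fun z hz => hδJ ⟨by linarith [hz.1], by linarith [hz.2]⟩)
    (hbelow _ (by linarith) (by linarith)) (hbelow _ (by linarith) (by linarith))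
  rcases le_total t (d - 20 * e + 24 * e) with h1 | h1
  · exact htD (hD.out hx h ⟨by linarith, h1⟩)
  · have := le_csSup hbdd (show d - 20 * e + 24 * e ∈ S from ⟨h, by linarith, h1⟩)
    linarith

theorem neg_preimage_interior (J : Set ℝ) :
    interior (Neg.neg ⁻¹' J) = Neg.neg ⁻¹' interior J :=
  ((Homeomorph.neg ℝ).preimage_interior J).symm

theorem neg_preimage_ordConnected {J : Set ℝ} (hJ : J.OrdConnected) :
    (Neg.neg ⁻¹' J : Set ℝ).OrdConnected :=
  ⟨fun _ hx _ hy _ hz => hJ.out hy hx ⟨neg_le_neg hz.2, neg_le_neg hz.1⟩⟩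

end Order

/-! ### Extended-valued convex functions and their one-sided limits. -/

section Convex

variable {f : ℝ → EReal} {J : Set ℝ}

theorem ExtConvexOn.mono (hf : ExtConvexOn f J) {I : Set ℝ} (h : I ⊆ J) : ExtConvexOn f I :=
  fun x hx y hy => hf x (h hx) y (h hy)

theorem ExtConvexOn.comp_neg (hf : ExtConvexOn f J) :
    ExtConvexOn (fun x => f (-x)) (Neg.neg ⁻¹' J) := fun x hx y hy r h0 h1 => by
  have := hf (-x) hx (-y) hy r h0 h1
  rwa [show (1 - r) * -x + r * -y = -((1 - r) * x + r * y) by ring] at this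

theorem ExtConvexOn.ordConnected_finite (hJ : J.OrdConnected) (hbot : ∀ t ∈ J, f t ≠ ⊥)
    (hf : ExtConvexOn f J) : {t ∈ J | f t ≠ ⊤}.OrdConnected := by
  refine ordConnected_of_Ioo fun x hx y hy hxy z hz => ⟨hJ.out hx.1 hy.1 ⟨hz.1.le, hz.2.le⟩, ?_⟩
  have hyx : 0 < y - x := sub_pos.mpr hxy
  have h := hf x hx.1 y hy.1 ((z - x) / (y - x)) (div_pos (by linarith [hz.1]) hyx)
    ((div_lt_one hyx).mpr (by linarith [hz.2]))
  rw [show (1 - (z - x) / (y - x)) * x + (z - x) / (y - x) * y = z by field_simp; ring] at h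
  intro htop
  lift f x to ℝ using ⟨hx.2, hbot x hx.1⟩ with p
  lift f y to ℝ using ⟨hy.2, hbot y hy.1⟩ with q
  rw [htop, top_le_iff] at h
  exact EReal.coe_ne_top _ h

theorem ExtConvexOn.toReal (hbot : ∀ t ∈ J, f t ≠ ⊥) (htop : ∀ t ∈ J, f t ≠ ⊤)
    (hJ : J.OrdConnected) (hf : ExtConvexOn f J) : ConvexOn ℝ J fun t => (f t).toReal := by
  refine ⟨hJ.convex, fun x hx y hy a b ha hb hab => ?_⟩
  rcases ha.eq_or_lt with rfl | ha
  · obtain rfl : b = 1 := by linarith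
    simp
  rcases hb.eq_or_lt with rfl | hb
  · obtain rfl : a = 1 := by linarith
    simp
  obtain rfl : a = 1 - b := by linarith
  have hz := hJ.convex hx hy ha.le hb.le hab
  have h := hf x hx y hy b hb (by linarith)
  simp only [smul_eq_mul] at hz ⊢
  rw [← EReal.coe_toReal (htop _ hx) (hbot _ hx), ← EReal.coe_toReal (htop _ hy) (hbot _ hy),
    ← EReal.coe_toReal (htop _ hz) (hbot _ hz)] at h
  exact_mod_cast h

/-- A convex function is monotone near the left end, one way or the other, so the limit exists in
the extended reals. Letting the chord from `a` to `c` shrink towards `a` bounds the limit by `f a`.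
-/
theorem ExtConvexOn.exists_tendsto_nhdsGT {a c : ℝ} (hac : a < c) {m : ℝ}
    (hm : ∀ t ∈ Icc a c, (m : EReal) ≤ f t) (htop : ∀ t ∈ Ioc a c, f t ≠ ⊤)
    (hf : ExtConvexOn f (Icc a c)) :
    ∃ l : EReal, l ≠ ⊥ ∧ Tendsto f (𝓝[>] a) (𝓝 l) ∧ l ≤ f a := by
  have hbot : ∀ t ∈ Icc a c, f t ≠ ⊥ := fun t ht h => by
    have := hm t ht; rw [h, le_bot_iff] at this; exact EReal.coe_ne_bot _ this
  have hlim : ∃ l : EReal, Tendsto f (𝓝[>] a) (𝓝 l) := by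
    have hg := (hf.mono Ioc_subset_Icc_self).toReal (fun t ht => hbot t (Ioc_subset_Icc_self ht))
      htop ordConnected_Ioc
    by_cases hmono : MonotoneOn f (Ioo a c)
    · exact ⟨_, hmono.tendsto_nhdsWithin_Ioo_right (nonempty_Ioo.mpr hac)
        (OrderBot.bddBelow _)⟩
    · simp only [MonotoneOn, not_forall, not_le] at hmono
      obtain ⟨p, hp, q, hq, hpq, hlt⟩ := hmono
      have hpq : p < q := lt_of_le_of_ne hpq fun h => by rw [h] at hlt; exact lt_irrefl _ hlt
      have hco : ∀ t ∈ Ioo a c, ((f t).toReal : EReal) = f t := fun t ht =>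
        EReal.coe_toReal (htop t ⟨ht.1, ht.2.le⟩) (hbot t ⟨ht.1.le, ht.2.le⟩)
      have hlt' : (f q).toReal < (f p).toReal := by
        rw [← hco p hp, ← hco q hq] at hlt; exact_mod_cast hlt
      -- One strict descent from `p` to `q` forces, by increasing slopes, negative slopes everywhere
      -- to the left of `p`.
      have hanti : AntitoneOn f (Ioo a p) := by
        intro x hx y hy hxy
        rcases hxy.eq_or_lt with rfl | hxy
        · exact le_rfl
        have hx' : x ∈ Ioo a c := ⟨hx.1, hx.2.trans hp.2⟩
        have hy' : y ∈ Ioo a c := ⟨hy.1, hy.2.trans hp.2⟩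
        rw [← hco x hx', ← hco y hy']
        have h1 := hg.slope_mono_adjacent (Ioo_subset_Ioc_self hx') (Ioo_subset_Ioc_self hp) hxy hy.2
        have h2 := hg.slope_mono_adjacent (Ioo_subset_Ioc_self hy') (Ioo_subset_Ioc_self hq) hy.2 hpq
        have h3 : ((f q).toReal - (f p).toReal) / (q - p) < 0 :=
          div_neg_of_neg_of_pos (by linarith) (by linarith)
        have h4 : ((f y).toReal - (f x).toReal) / (y - x) < 0 := by linarith
        have h5 : (f y).toReal - (f x).toReal < 0 := by
          by_contra! h
          exact absurd (div_nonneg h (by linarith : 0 ≤ y - x)) (not_le.mpr h4)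
        exact_mod_cast (by linarith : (f y).toReal ≤ (f x).toReal)
      exact ⟨_, hanti.tendsto_nhdsWithin_Ioo_right (nonempty_Ioo.mpr hp.1)
        (OrderTop.bddAbove _)⟩
  obtain ⟨l, hl⟩ := hlim
  have hml : (m : EReal) ≤ l := ge_of_tendsto hl (by
    filter_upwards [Ioo_mem_nhdsGT hac] with t ht using hm t ⟨ht.1.le, ht.2.le⟩)
  refine ⟨l, fun h => ?_, hl, ?_⟩
  · rw [h, le_bot_iff] at hml; exact EReal.coe_ne_bot _ hml
  by_cases hfa : f a = ⊤
  · rw [hfa]; exact le_top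
  have ha : a ∈ Icc a c := left_mem_Icc.mpr hac.le
  have hc : c ∈ Icc a c := right_mem_Icc.mpr hac.le
  have hpt : Tendsto (fun r : ℝ => (1 - r) * a + r * c) (𝓝[>] 0) (𝓝[>] a) := by
    refine tendsto_nhdsWithin_of_tendsto_nhds_of_eventually_within _ ?_ ?_
    · have : Tendsto (fun r : ℝ => (1 - r) * a + r * c) (𝓝 0) (𝓝 ((1 - 0) * a + 0 * c)) :=
        Continuous.tendsto (by fun_prop) 0
      simp only [sub_zero, one_mul, zero_mul, add_zero] at this
      exact this.mono_left nhdsWithin_le_nhds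
    · filter_upwards [self_mem_nhdsWithin] with r hr
      have hr : 0 < r := hr
      simp only [mem_Ioi]; nlinarith
  have hrhs : Tendsto (fun r : ℝ => (((1 - r) * (f a).toReal + r * (f c).toReal : ℝ) : EReal))
      (𝓝[>] 0) (𝓝 (f a)) := by
    have : Tendsto (fun r : ℝ => (1 - r) * (f a).toReal + r * (f c).toReal) (𝓝 0)
        (𝓝 ((1 - 0) * (f a).toReal + 0 * (f c).toReal)) := Continuous.tendsto (by fun_prop) 0
    simp only [sub_zero, one_mul, zero_mul, add_zero] at this
    have h2 := (EReal.tendsto_coe.mpr this)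
    rw [EReal.coe_toReal hfa (hbot a ha)] at h2
    exact h2.mono_left nhdsWithin_le_nhds
  refine le_of_tendsto_of_tendsto (hl.comp hpt) hrhs ?_
  filter_upwards [Ioo_mem_nhdsGT (zero_lt_one' ℝ)] with r hr
  have h := hf a ha c hc r hr.1 hr.2
  rw [← EReal.coe_toReal hfa (hbot a ha),
    ← EReal.coe_toReal (htop c ⟨hac, le_rfl⟩) (hbot c hc)] at h
  simp only [Function.comp_apply]
  exact_mod_cast h

end Convex

/-! ### Necessity: finiteness in the interior and endpoint limits. -/

section Necessity

variable {f : ℝ → EReal} {J : Set ℝ}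

theorem ExtOperatorConvexOn.extConvexOn (hJ : J.OrdConnected) (hbot : ∀ t ∈ J, f t ≠ ⊥)
    (hf : ExtOperatorConvexOn.{u} f J) : ExtConvexOn f J :=
  fun _ hx _ hy _ h0 h1 => hf.scalar hJ hbot hx hy h0 h1

theorem ExtOperatorConvexOn.mono (hf : ExtOperatorConvexOn.{u} f J) {I : Set ℝ} (h : I ⊆ J) :
    ExtOperatorConvexOn.{u} f I :=
  fun H _ _ _ A hA B hB => hf H A ⟨hA.1, hA.2.trans h⟩ B ⟨hB.1, hB.2.trans h⟩

theorem ExtOperatorMonotoneOn.mono (hf : ExtOperatorMonotoneOn.{u} f J) {I : Set ℝ} (h : I ⊆ J) :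
    ExtOperatorMonotoneOn.{u} f I :=
  fun H _ _ _ A hA B hB => hf H A ⟨hA.1, hA.2.trans h⟩ B ⟨hB.1, hB.2.trans h⟩

theorem ExtOperatorConvexOn.real_on_interior (hJ : J.OrdConnected) (hbot : ∀ t ∈ J, f t ≠ ⊥)
    (hfin : ∃ s ∈ J, ∃ t ∈ J, s < t ∧ f s ≠ ⊤ ∧ f t ≠ ⊤)
    (hf : ExtOperatorConvexOn.{u} f J) : ∀ t ∈ interior J, f t ≠ ⊤ := by
  obtain ⟨x, hx, y, hy, hxy, hfx, hfy⟩ := hfin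
  obtain ⟨K, hK, hext⟩ := hf.exists_finite_of_finite hbot
  have hD := (hf.extConvexOn hJ hbot).ordConnected_finite hJ hbot
  set D := {t ∈ J | f t ≠ ⊤} with hDdef
  have hDJ : D ⊆ J := fun z hz => hz.1
  intro t ht
  rcases le_total y t with h | h
  · refine (mem_of_extension_right hJ hD hDJ ⟨hx, hfx⟩ ⟨hy, hfy⟩ hxy (by linarith : 0 < K)
      (fun e s he hs h1 h2 => ⟨hs ⟨by nlinarith, by nlinarith⟩, hext e s ?_ h1.2 h2.2⟩) ht h).2
    rwa [abs_of_pos he]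
  rcases le_total x t with h' | h'
  · exact (hD.out ⟨hx, hfx⟩ ⟨hy, hfy⟩ ⟨h', h⟩).2
  -- Extension to the left is extension to the right after `x ↦ -x`; the matrix inequality is used
  -- with `-e`.
  · have hm := mem_of_extension_right (neg_preimage_ordConnected hJ) (neg_preimage_ordConnected hD)
      (preimage_mono hDJ) (x := -y) (y := -x) (by simpa using ⟨hy, hfy⟩) (by simpa using ⟨hx, hfx⟩)
      (neg_lt_neg hxy) (by linarith : 0 < K) (fun e s he hs h1 h2 => ?_) (t := -t)
      (by rw [neg_preimage_interior]; simpa using ht) (neg_le_neg h')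
    · simpa using hm.2
    · have hs' : Icc (-s - K * |(-e)|) (-s + K * |(-e)|) ⊆ J := fun z hz => by
        rw [abs_neg, abs_of_pos he] at hz
        have := @hs (-z) ⟨by linarith [hz.2], by linarith [hz.1]⟩
        simpa using this
      have h3 := hext (-e) (-s) hs' (by convert h1.2 using 2; ring) (by convert h2.2 using 2; ring)
      have h4 : -(s + 24 * e) ∈ J := hs' ⟨by rw [abs_neg, abs_of_pos he]; nlinarith,
        by rw [abs_neg, abs_of_pos he]; nlinarith⟩
      exact ⟨h4, by convert h3 using 2; ring⟩

theorem ExtOperatorMonotoneOn.real_on_interior (hJ : J.OrdConnected) (hbot : ∀ t ∈ J, f t ≠ ⊥)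
    (hfin : ∃ s ∈ J, ∃ t ∈ J, s < t ∧ f s ≠ ⊤ ∧ f t ≠ ⊤)
    (hf : ExtOperatorMonotoneOn.{u} f J) : ∀ t ∈ interior J, f t ≠ ⊤ := by
  obtain ⟨x, hx, y, hy, hxy, hfx, hfy⟩ := hfin
  obtain ⟨K, hK, hext⟩ := hf.exists_scalar_inequality hbot
  have hlow : ∀ s ∈ J, ∀ t ∈ J, s ≤ t → f t ≠ ⊤ → f s ≠ ⊤ := fun s hs t ht hst h =>
    ne_top_of_le_ne_top h (hf.scalar hbot hs ht hst)
  set D := {t ∈ J | f t ≠ ⊤} with hDdef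
  have hDJ : D ⊆ J := fun z hz => hz.1
  have hD : D.OrdConnected := ⟨fun s hs t ht z hz =>
    ⟨hJ.out hs.1 ht.1 hz, hlow z (hJ.out hs.1 ht.1 hz) t ht.1 hz.2 ht.2⟩⟩
  intro t ht
  rcases le_total t y with h | h
  · exact hlow t (interior_subset ht) y hy h hfy
  refine (mem_of_extension_right hJ hD hDJ ⟨hx, hfx⟩ ⟨hy, hfy⟩ hxy (K := 2 * K + 24) (by linarith)
    (fun e s he hs h1 h2 => ?_) ht h).2
  have hKe : 0 < K * e := by positivity
  have hmem : ∀ z, |z| ≤ 24 → s + z * e ∈ J := fun z hz => hs <| by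
    have := abs_le.mp hz
    constructor <;> nlinarith
  have h24 := hmem 24 (by norm_num)
  have h6 := hmem 6 (by norm_num)
  refine ⟨h24, fun htop => ?_⟩
  -- With this centre and scale the outer points are `s + 24e` and `s + 6e`, so finiteness at `s +
  -- 15e` alone gives finiteness at `s + 24e`.
  have h3 := hext (3 / 2 * e) (s + 15 * e) (by positivity)
    (fun z hz => hs ⟨by linarith [hz.1], by linarith [hz.2]⟩)
  rw [show s + 15 * e + 6 * (3 / 2 * e) = s + 24 * e by ring, htop,
    show s + 15 * e - 6 * (3 / 2 * e) = s + 6 * e by ring, EReal.top_add_of_ne_bot, top_le_iff] at h3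
  · lift f (s + 15 * e) to ℝ using ⟨h1.2, hbot _ h1.1⟩ with p
    exact EReal.coe_ne_top (5 * p) (by exact_mod_cast h3)
  · rw [EReal.mul_ne_bot]
    exact ⟨.inl (EReal.coe_ne_bot 4), .inr (hbot _ h6), .inl (EReal.coe_ne_top 4),
      .inl (by exact_mod_cast (by norm_num : (0 : ℝ) ≤ 4))⟩

theorem ExtOperatorConvexOn.tendsto_left (hJ : J.OrdConnected) (hbot : ∀ t ∈ J, f t ≠ ⊥)
    (hlb : LocallyBoundedBelowOn f J)
    (hfin : ∃ s ∈ J, ∃ t ∈ J, s < t ∧ f s ≠ ⊤ ∧ f t ≠ ⊤)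
    (hf : ExtOperatorConvexOn.{u} f J) {a : ℝ} (ha : IsLeast J a) :
    ∃ l : EReal, l ≠ ⊥ ∧ Tendsto f (𝓝[>] a) (𝓝 l) ∧ l ≤ f a := by
  obtain ⟨s, hs, c, hc, hsc, -, hfc⟩ := id hfin
  have hac : a < c := (ha.2 hs).trans_lt hsc
  have hsub : Icc a c ⊆ J := hJ.out ha.1 hc
  obtain ⟨m, hm⟩ := hlb _ hsub isCompact_Icc
  refine ((hf.extConvexOn hJ hbot).mono hsub).exists_tendsto_nhdsGT hac hm fun t ht => ?_
  rcases ht.2.eq_or_lt with rfl | h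
  · exact hfc
  · exact hf.real_on_interior hJ hbot hfin t (Ioo_subset_interior_of_mem hJ ha.1 hc ⟨ht.1, h⟩)

theorem ExtOperatorConvexOn.tendsto_right (hJ : J.OrdConnected) (hbot : ∀ t ∈ J, f t ≠ ⊥)
    (hlb : LocallyBoundedBelowOn f J)
    (hfin : ∃ s ∈ J, ∃ t ∈ J, s < t ∧ f s ≠ ⊤ ∧ f t ≠ ⊤)
    (hf : ExtOperatorConvexOn.{u} f J) {b : ℝ} (hb : IsGreatest J b) :
    ∃ l : EReal, l ≠ ⊥ ∧ Tendsto f (𝓝[<] b) (𝓝 l) ∧ l ≤ f b := by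
  obtain ⟨c, hc, s, hs, hcs, hfc, -⟩ := id hfin
  have hcb : c < b := hcs.trans_le (hb.2 hs)
  have hsub : Icc c b ⊆ J := hJ.out hc hb.1
  obtain ⟨m, hm⟩ := hlb _ hsub isCompact_Icc
  have hneg : ∀ t ∈ Icc (-b) (-c), -t ∈ Icc c b := fun t ht =>
    ⟨by linarith [ht.2], by linarith [ht.1]⟩
  obtain ⟨l, hl, ht, hle⟩ := ExtConvexOn.exists_tendsto_nhdsGT (f := fun x => f (-x))
    (neg_lt_neg hcb) (m := m) (fun t ht => hm _ (hneg t ht))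
    (fun t ht => by
      rcases ht.2.eq_or_lt with rfl | h
      · simpa using hfc
      · exact hf.real_on_interior hJ hbot hfin _ (Ioo_subset_interior_of_mem hJ hc hb.1
          ⟨by linarith, by linarith [ht.1]⟩))
    (((hf.extConvexOn hJ hbot).mono hsub).comp_neg.mono hneg)
  refine ⟨l, hl, ?_, by simpa using hle⟩
  simpa [Function.comp_def] using ht.comp (tendsto_neg_nhdsLT (a := b))

theorem ExtOperatorMonotoneOn.tendsto_left (hJ : J.OrdConnected) (hbot : ∀ t ∈ J, f t ≠ ⊥)
    (hfin : ∃ s ∈ J, ∃ t ∈ J, s < t ∧ f s ≠ ⊤ ∧ f t ≠ ⊤)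
    (hf : ExtOperatorMonotoneOn.{u} f J) {a : ℝ} (ha : IsLeast J a) :
    ∃ l : EReal, l ≠ ⊥ ∧ Tendsto f (𝓝[>] a) (𝓝 l) ∧ f a ≤ l := by
  obtain ⟨s, hs, c, hc, hsc, -, -⟩ := hfin
  have hac : a < c := (ha.2 hs).trans_lt hsc
  have hsub : Icc a c ⊆ J := hJ.out ha.1 hc
  have hmono : MonotoneOn f (Icc a c) := fun x hx y hy => hf.scalar hbot (hsub hx) (hsub hy)
  have hlim := (hmono.mono Ioo_subset_Icc_self).tendsto_nhdsWithin_Ioo_right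
    (nonempty_Ioo.mpr hac) (OrderBot.bddBelow _)
  have hle := ge_of_tendsto hlim (b := f a) (by
    filter_upwards [Ioo_mem_nhdsGT hac] with t ht using
      hmono (left_mem_Icc.mpr hac.le) (Ioo_subset_Icc_self ht) ht.1.le)
  exact ⟨_, ne_bot_of_le_ne_bot (hbot a ha.1) hle, hlim, hle⟩

theorem ExtOperatorMonotoneOn.tendsto_right (hJ : J.OrdConnected) (hbot : ∀ t ∈ J, f t ≠ ⊥)
    (hfin : ∃ s ∈ J, ∃ t ∈ J, s < t ∧ f s ≠ ⊤ ∧ f t ≠ ⊤)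
    (hf : ExtOperatorMonotoneOn.{u} f J) {b : ℝ} (hb : IsGreatest J b) :
    ∃ l : EReal, l ≠ ⊥ ∧ Tendsto f (𝓝[<] b) (𝓝 l) ∧ l ≤ f b := by
  obtain ⟨c, hc, s, hs, hcs, -, -⟩ := hfin
  have hcb : c < b := hcs.trans_le (hb.2 hs)
  have hsub : Icc c b ⊆ J := hJ.out hc hb.1
  have hmono : MonotoneOn f (Icc c b) := fun x hx y hy => hf.scalar hbot (hsub hx) (hsub hy)
  have hlim := (hmono.mono Ioo_subset_Icc_self).tendsto_nhdsWithin_Ioo_left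
    (nonempty_Ioo.mpr hcb) (OrderTop.bddAbove _)
  have hle := le_of_tendsto hlim (b := f b) (by
    filter_upwards [Ioo_mem_nhdsLT hcb] with t ht using
      hmono (Ioo_subset_Icc_self ht) (right_mem_Icc.mpr hcb.le) ht.2.le)
  have hge := ge_of_tendsto hlim (b := f c) (by
    filter_upwards [Ioo_mem_nhdsLT hcb] with t ht using
      hmono (left_mem_Icc.mpr hcb.le) (Ioo_subset_Icc_self ht) ht.1.le)
  exact ⟨_, ne_bot_of_le_ne_bot (hbot c hc) hge, hlim, hle⟩

end Necessity

/-! ### Passage to the limit in integrals, and contraction towards an interior point. -/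

section LimitTheorems

/-- Convergence of integrals of nonnegative functions dominated by their limit plus a constant. -/
theorem tendsto_lintegral_of_le_add {X : Type*} [MeasurableSpace X] {μ : Measure X}
    [IsFiniteMeasure μ] {G : ℕ → X → ℝ≥0∞} {F : X → ℝ≥0∞} {k : ℝ≥0∞} (hk : k ≠ ⊤)
    (hG : ∀ n, Measurable (G n))
    (hle : ∀ n, ∀ᵐ x ∂μ, G n x ≤ F x + k)
    (hlim : ∀ᵐ x ∂μ, Tendsto (fun n => G n x) atTop (𝓝 (F x))) :
    Tendsto (fun n => ∫⁻ x, G n x ∂μ) atTop (𝓝 (∫⁻ x, F x ∂μ)) := by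
  by_cases h : ∫⁻ x, F x ∂μ = ⊤
  -- When the limit integral is infinite no integrable majorant exists, but Fatou's lemma already
  -- forces divergence to `⊤`.
  · have hfatou : ∫⁻ x, F x ∂μ ≤ liminf (fun n => ∫⁻ x, G n x ∂μ) atTop := by
      refine le_trans (lintegral_mono_ae ?_) (lintegral_liminf_le hG)
      filter_upwards [hlim] with x hx using hx.liminf_eq.ge
    rw [h, top_le_iff] at hfatou
    rw [h]
    exact tendsto_of_le_liminf_of_limsup_le hfatou.ge le_top
  · refine tendsto_lintegral_of_dominated_convergence (fun x => F x + k) hG hle ?_ hlim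
    rw [lintegral_add_right _ measurable_const, lintegral_const]
    exact ENNReal.add_ne_top.mpr ⟨h, ENNReal.mul_ne_top hk (measure_ne_top _ _)⟩

theorem lintegral_indicator_singleton_const (μ : Measure ℝ) (a : ℝ) (j : ℝ≥0∞) :
    ∫⁻ t, ({a} : Set ℝ).indicator (fun _ => j) t ∂μ = j * μ {a} :=
  lintegral_indicator_const (measurableSet_singleton a) j

end LimitTheorems

/-- The function `f + M` cut off outside `[α, β]`. -/
noncomputable def shiftedCutoff (f : ℝ → EReal) (M α β : ℝ) : ℝ → ℝ≥0∞ :=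
  (Icc α β).indicator fun t => (f t + (M : EReal)).toENNReal

theorem shiftedCutoff_of_mem {f : ℝ → EReal} {M α β t : ℝ} (ht : t ∈ Icc α β) :
    shiftedCutoff f M α β t = (f t + (M : EReal)).toENNReal :=
  indicator_of_mem ht _

theorem measurable_shiftedCutoff {f : ℝ → EReal} {M α β : ℝ}
    (hf : Measurable fun t : Icc α β => f t) : Measurable (shiftedCutoff f M α β) := by
  refine measurable_of_restrict_of_restrict_compl (s := Icc α β) measurableSet_Icc ?_ ?_
  · have : (Icc α β).domRestrict (shiftedCutoff f M α β)
        = fun t : Icc α β => (f t + (M : EReal)).toENNReal :=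
      funext fun t => shiftedCutoff_of_mem t.2
    rw [this]
    exact (hf.add_const _).ereal_toENNReal
  · have : (Icc α β)ᶜ.domRestrict (shiftedCutoff f M α β) = fun _ => 0 :=
      funext fun t => by simp [shiftedCutoff, indicator_of_notMem t.2]
    rw [this]
    exact measurable_const

/-- Replace the values of `f` at two points. -/
noncomputable def replaceEndpoints (f : ℝ → EReal) (α β : ℝ) (l l' : EReal) : ℝ → EReal :=
  Function.update (Function.update f α l) β l'

section ReplaceEndpoints

variable {f : ℝ → EReal} {α β : ℝ} {l l' : EReal}

theorem replaceEndpoints_left (h : α < β) : replaceEndpoints f α β l l' α = l := by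
  simp [replaceEndpoints, h.ne]

theorem replaceEndpoints_right : replaceEndpoints f α β l l' β = l' := by
  simp [replaceEndpoints]

theorem replaceEndpoints_of_mem_Ioo {t : ℝ} (ht : t ∈ Ioo α β) :
    replaceEndpoints f α β l l' t = f t := by
  simp [replaceEndpoints, ht.1.ne', ht.2.ne]

theorem continuousOn_replaceEndpoints (h : α < β) (hf : ContinuousOn f (Ioo α β))
    (hl : Tendsto f (𝓝[>] α) (𝓝 l)) (hl' : Tendsto f (𝓝[<] β) (𝓝 l')) :
    ContinuousOn (replaceEndpoints f α β l l') (Icc α β) := by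
  have hev : ∀ t ∈ Ioo α β, replaceEndpoints f α β l l' =ᶠ[𝓝 t] f := fun t ht => by
    filter_upwards [isOpen_Ioo.mem_nhds ht] with x hx using replaceEndpoints_of_mem_Ioo hx
  intro t ht
  rcases ht.1.eq_or_lt with rfl | h1
  · rw [ContinuousWithinAt, replaceEndpoints_left h, ← Ioc_insert_left h.le, nhdsWithin_insert,
      tendsto_sup]
    refine ⟨by rw [tendsto_pure_left]; intro s hs; rw [replaceEndpoints_left h]; exact mem_of_mem_nhds hs, ?_⟩
    rw [nhdsWithin_Ioc_eq_nhdsGT h]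
    refine hl.congr' ?_
    filter_upwards [Ioo_mem_nhdsGT h] with x hx using (replaceEndpoints_of_mem_Ioo hx).symm
  rcases ht.2.eq_or_lt with rfl | h2
  · rw [ContinuousWithinAt, replaceEndpoints_right, ← Ico_insert_right h.le, nhdsWithin_insert,
      tendsto_sup]
    refine ⟨by rw [tendsto_pure_left]; intro s hs; rw [replaceEndpoints_right]; exact mem_of_mem_nhds hs, ?_⟩
    rw [nhdsWithin_Ico_eq_nhdsLT h]
    refine hl'.congr' ?_
    filter_upwards [Ioo_mem_nhdsLT h] with x hx using (replaceEndpoints_of_mem_Ioo hx).symm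
  · exact ((hf.continuousAt (isOpen_Ioo.mem_nhds ⟨h1, h2⟩)).congr
      (hev t ⟨h1, h2⟩).symm).continuousWithinAt

end ReplaceEndpoints

section Contraction

theorem combo_mem_Ioo {α β c : ℝ} (hc : c ∈ Ioo α β) {e t : ℝ} (he0 : 0 < e) (he1 : e < 1)
    (ht : t ∈ Icc α β) : (1 - e) * t + e * c ∈ Ioo α β := by
  have h1 := mul_pos he0 (sub_pos.mpr hc.1)
  have h2 := mul_pos he0 (sub_pos.mpr hc.2)
  have h3 := mul_nonneg (sub_nonneg.mpr he1.le) (sub_nonneg.mpr ht.1)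
  have h4 := mul_nonneg (sub_nonneg.mpr he1.le) (sub_nonneg.mpr ht.2)
  constructor <;> nlinarith

theorem continuousOn_shiftedCutoff {f : ℝ → EReal} {M α β : ℝ} (hf : ContinuousOn f (Icc α β)) :
    ContinuousOn (shiftedCutoff f M α β) (Icc α β) := by
  have h : ContinuousOn (fun t => (f t + (M : EReal)).toENNReal) (Icc α β) := by
    refine EReal.continuous_toENNReal.comp_continuousOn fun t ht => ?_
    have h2 : ContinuousAt (fun p : EReal × EReal => p.1 + p.2) (f t, (M : EReal)) :=
      EReal.continuousAt_add (.inr (EReal.coe_ne_bot M)) (.inr (EReal.coe_ne_top M))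
    exact h2.comp_continuousWithinAt (f := fun t => (f t, (M : EReal))) ((hf t ht).prodMk continuousWithinAt_const)
  exact h.congr fun t ht => shiftedCutoff_of_mem ht

/-- Contracting the interval towards an interior point recovers, in the limit, the integral of the
function with its endpoint values replaced by one-sided limits. -/
theorem tendsto_lintegral_shiftedCutoff {f : ℝ → EReal} {M α β c : ℝ} {l l' : EReal}
    (hc : c ∈ Ioo α β) (hmeas : Measurable fun t : Icc α β => f t)
    (hf : ContinuousOn f (Ioo α β)) (hl : Tendsto f (𝓝[>] α) (𝓝 l))
    (hl' : Tendsto f (𝓝[<] β) (𝓝 l')) (hfc : f c ≠ ⊤)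
    (hdom : ∀ t ∈ Ioo α β, ∀ e : ℝ, 0 < e → e < 1 →
      shiftedCutoff f M α β ((1 - e) * t + e * c)
        ≤ shiftedCutoff f M α β t + shiftedCutoff f M α β c)
    {μ : Measure ℝ} [IsFiniteMeasure μ] (hμ : ∀ᵐ t ∂μ, t ∈ Icc α β)
    {e : ℕ → ℝ} (he0 : ∀ n, 0 < e n) (he1 : ∀ n, e n < 1) (he : Tendsto e atTop (𝓝 0)) :
    Tendsto (fun n => ∫⁻ t, shiftedCutoff f M α β ((1 - e n) * t + e n * c) ∂μ) atTop
      (𝓝 (∫⁻ t, shiftedCutoff (replaceEndpoints f α β l l') M α β t ∂μ)) := by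
  have hαβ : α < β := hc.1.trans hc.2
  set F := shiftedCutoff f M α β with hFdef
  set F' := shiftedCutoff (replaceEndpoints f α β l l') M α β with hF'
  have heq : ∀ t ∈ Ioo α β, F t = F' t := fun t ht => by
    rw [hFdef, hF', shiftedCutoff_of_mem (Ioo_subset_Icc_self ht),
      shiftedCutoff_of_mem (Ioo_subset_Icc_self ht), replaceEndpoints_of_mem_Ioo ht]
  have hcont : ContinuousOn F' (Icc α β) :=
    continuousOn_shiftedCutoff (continuousOn_replaceEndpoints hαβ hf hl hl')
  have hFm : Measurable F := measurable_shiftedCutoff hmeas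
  have hFc : F c ≠ ⊤ := by
    rw [hFdef, shiftedCutoff_of_mem (Ioo_subset_Icc_self hc), Ne, EReal.toENNReal_eq_top_iff]
    exact EReal.add_ne_top hfc (EReal.coe_ne_top M)
  refine tendsto_lintegral_of_le_add hFc (fun n => hFm.comp (by fun_prop)) (fun n => ?_) ?_
  · have hcl : closure (Ioo α β) = Icc α β := closure_Ioo hαβ.ne
    have hmaps : MapsTo (fun t => (1 - e n) * t + e n * c) (Icc α β) (Icc α β) := fun t ht =>
      Ioo_subset_Icc_self (combo_mem_Ioo hc (he0 n) (he1 n) ht)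
    -- The domination is assumed only in the open interval. It extends to the endpoints by
    -- continuity of `F'`, whose values there are the one-sided limits.
    have hle : ∀ t ∈ closure (Ioo α β), F' ((1 - e n) * t + e n * c) ≤ F' t + F c := by
      intro t ht
      refine le_on_closure (f := fun t => F' ((1 - e n) * t + e n * c)) (g := fun t => F' t + F c)
        (s := Ioo α β) (fun t ht => ?_) ?_ ?_ ht
      · rw [← heq t ht, ← heq _ (combo_mem_Ioo hc (he0 n) (he1 n) (Ioo_subset_Icc_self ht))]
        exact hdom t ht _ (he0 n) (he1 n)
      · rw [hcl]; exact hcont.comp (by fun_prop) hmaps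
      · rw [hcl]; exact hcont.add continuousOn_const
    filter_upwards [hμ] with t ht
    rw [heq _ (combo_mem_Ioo hc (he0 n) (he1 n) ht)]
    exact hle t (hcl ▸ ht)
  · filter_upwards [hμ] with t ht
    have h1 : Tendsto (fun n => (1 - e n) * t + e n * c) atTop (𝓝[Icc α β] t) := by
      refine tendsto_nhdsWithin_of_tendsto_nhds_of_eventually_within _ ?_
        (.of_forall fun n => Ioo_subset_Icc_self (combo_mem_Ioo hc (he0 n) (he1 n) ht))
      have := ((he.const_sub 1).mul_const t).add (he.mul_const c)
      simpa using this
    refine ((hcont t ht).tendsto.comp h1).congr fun n => ?_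
    exact (heq _ (combo_mem_Ioo hc (he0 n) (he1 n) ht)).symm

end Contraction

/-! ### From `extApply` to nonnegative integrals; enclosing and contracting spectra; atoms of
combinations. -/

section Bridge

variable {H : Type*} [NormedAddCommGroup H] [InnerProductSpace ℂ H] [CompleteSpace H]

theorem extApply_add_eq_lintegral_shiftedCutoff {f : ℝ → EReal} {A : H →L[ℂ] H}
    (hA : IsSelfAdjoint A) (ρ : NormalPositiveFunctional H) {M α β : ℝ} (hM : 0 ≤ M)
    (hsp : spectrum ℝ A ⊆ Icc α β) (hf : ∀ t ∈ Icc α β, ((-M : ℝ) : EReal) ≤ f t)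
    (hmeas : Measurable fun t : Icc α β => f t) :
    extApply f A ρ + ((M * (ρ.toFun 1).re : ℝ) : EReal)
      = ((∫⁻ t, shiftedCutoff f M α β t ∂(scalarSpectralMeasure A ρ) : ℝ≥0∞) : EReal) := by
  rw [extApply_add_const hA ρ hM (fun t ht => hf t (hsp ht)) (hmeas.comp (measurable_inclusion hsp)),
    restrict_scalarSpectralMeasure]
  congr 1
  refine lintegral_congr_ae ?_
  filter_upwards [ae_mem_spectrum A ρ] with t ht
  exact (shiftedCutoff_of_mem (hsp ht)).symm

theorem EReal.add_coe_le_add_coe_iff {x y : EReal} (c : ℝ) :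
    x + (c : EReal) ≤ y + (c : EReal) ↔ x ≤ y := by
  refine ⟨fun h => ?_, fun h => add_le_add_left h _⟩
  have := add_le_add_left h ((-c : ℝ) : EReal)
  rwa [add_assoc, add_assoc, ← EReal.coe_add, add_neg_cancel, EReal.coe_zero, add_zero,
    add_zero] at this

/-- The weights sum to 1, so adding the finite constant `c` to all three terms respects the
inequality and moves it to `ℝ≥0∞`. -/
theorem EReal.le_combo_iff {a b d : EReal} {c r : ℝ} {p q s : ℝ≥0∞} (h0 : 0 < r) (h1 : r < 1)
    (ha : a + (c : EReal) = p) (hb : b + (c : EReal) = q) (hd : d + (c : EReal) = s) :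
    d ≤ ((1 - r : ℝ) : EReal) * a + (r : EReal) * b
      ↔ s ≤ ENNReal.ofReal (1 - r) * p + ENNReal.ofReal r * q := by
  have hr : (0 : EReal) ≤ (r : EReal) := by exact_mod_cast h0.le
  have hr' : (0 : EReal) ≤ ((1 - r : ℝ) : EReal) := by exact_mod_cast (by linarith : 0 ≤ 1 - r)
  have key : ((1 - r : ℝ) : EReal) * a + (r : EReal) * b + (c : EReal)
      = ((ENNReal.ofReal (1 - r) * p + ENNReal.ofReal r * q : ℝ≥0∞) : EReal) := by
    rw [EReal.coe_ennreal_add, EReal.coe_ennreal_mul, EReal.coe_ennreal_mul,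
      EReal.coe_ennreal_ofReal, EReal.coe_ennreal_ofReal, max_eq_left h0.le,
      max_eq_left (by linarith : (0 : ℝ) ≤ 1 - r), ← ha, ← hb,
      EReal.left_distrib_of_nonneg_of_ne_top hr (EReal.coe_ne_top _),
      EReal.left_distrib_of_nonneg_of_ne_top hr' (EReal.coe_ne_top _), add_add_add_comm,
      ← EReal.coe_mul, ← EReal.coe_mul, ← EReal.coe_add]
    congr 2; ring
  rw [← EReal.add_coe_le_add_coe_iff c, key, hd, EReal.coe_ennreal_le_coe_ennreal_iff]

theorem lintegral_scalarSpectralMeasure_affine {A : H →L[ℂ] H} (hA : IsSelfAdjoint A)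
    (ρ : NormalPositiveFunctional H) (s c : ℝ) {F : ℝ → ℝ≥0∞} (hF : Measurable F) :
    ∫⁻ t, F t ∂(scalarSpectralMeasure (s • A + c • (1 : H →L[ℂ] H)) ρ)
      = ∫⁻ t, F (s * t + c) ∂(scalarSpectralMeasure A ρ) := by
  rw [scalarSpectralMeasure_affine A hA, lintegral_map hF (by fun_prop)]

theorem exists_Icc_of_spectra {J : Set ℝ} {A B : H →L[ℂ] H}
    (hA : spectrum ℝ A ⊆ J) (hB : spectrum ℝ B ⊆ J) {c : ℝ} (hc : c ∈ interior J) :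
    ∃ α ∈ J, ∃ β ∈ J, c ∈ Ioo α β ∧ spectrum ℝ A ⊆ Icc α β ∧ spectrum ℝ B ⊆ Icc α β := by
  obtain ⟨δ, hδ, hδJ⟩ := exists_Icc_subset_of_mem_interior hc
  -- The two extra points make the extremes of `S` lie strictly on either side of `c`.
  set S := spectrum ℝ A ∪ spectrum ℝ B ∪ {c - δ, c + δ} with hS
  have hSc : IsCompact S :=
    ((isCompact_spectrum_real A).union (isCompact_spectrum_real B)).union
      (Set.toFinite {c - δ, c + δ}).isCompact
  have hSJ : S ⊆ J := by
    refine union_subset (union_subset hA hB) ?_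
    rintro x (rfl | rfl)
    · exact hδJ ⟨le_rfl, by linarith⟩
    · exact hδJ ⟨by linarith, le_rfl⟩
  have hl : c - δ ∈ S := by simp [hS]
  have hr : c + δ ∈ S := by simp [hS]
  obtain ⟨α, hα, hαm⟩ := hSc.exists_isLeast ⟨_, hl⟩
  obtain ⟨β, hβ, hβm⟩ := hSc.exists_isGreatest ⟨_, hl⟩
  refine ⟨α, hSJ hα, β, hSJ hβ, ⟨?_, ?_⟩, fun x hx => ?_, fun x hx => ?_⟩
  · linarith [hαm hl]
  · linarith [hβm hr]
  · have : x ∈ S := .inl (.inl hx)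
    exact ⟨hαm this, hβm this⟩
  · have : x ∈ S := .inl (.inr hx)
    exact ⟨hαm this, hβm this⟩

theorem spectrum_subset_Icc_iff {A : H →L[ℂ] H} (hA : IsSelfAdjoint A) {α β : ℝ} :
    spectrum ℝ A ⊆ Icc α β ↔ α • (1 : H →L[ℂ] H) ≤ A ∧ A ≤ β • (1 : H →L[ℂ] H) := by
  rw [smul_one_le_iff_spectrum hA, le_smul_one_iff_spectrum hA]
  exact ⟨fun h => ⟨fun x hx => (h hx).1, fun x hx => (h hx).2⟩, fun h x hx => ⟨h.1 x hx, h.2 x hx⟩⟩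

theorem contraction_mem {J : Set ℝ} {α β c : ℝ} (hIoo : Ioo α β ⊆ J) (hc : c ∈ Ioo α β)
    {A : H →L[ℂ] H} (hA : IsSelfAdjoint A) (hsp : spectrum ℝ A ⊆ Icc α β) {e : ℝ} (he0 : 0 < e)
    (he1 : e < 1) :
    (1 - e) • A + (e * c) • (1 : H →L[ℂ] H) ∈ selfAdjointWithSpectrumIn H J ∧
      spectrum ℝ ((1 - e) • A + (e * c) • (1 : H →L[ℂ] H)) ⊆ Icc α β := by
  have h : spectrum ℝ ((1 - e) • A + (e * c) • (1 : H →L[ℂ] H)) ⊆ Ioo α β := by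
    refine (spectrum_affine_subset hA _ _).trans ?_
    rintro _ ⟨t, ht, rfl⟩
    exact combo_mem_Ioo hc he0 he1 (hsp ht)
  exact ⟨⟨isSelfAdjoint_affine hA _ _, h.trans hIoo⟩, h.trans Ioo_subset_Icc_self⟩

/-- Since `B ≥ α`, the combination dominates `rA + sα`, an affine image of `A` that fixes `α` and
hence has the same atom there. -/
theorem scalarSpectralMeasure_combo_left {A B : H →L[ℂ] H} (hA : IsSelfAdjoint A)
    (hB : IsSelfAdjoint B) {α r s : ℝ} (hr : 0 < r) (hs : 0 ≤ s) (hrs : r + s = 1)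
    (hAα : α • (1 : H →L[ℂ] H) ≤ A) (hBα : α • (1 : H →L[ℂ] H) ≤ B)
    (ρ : NormalPositiveFunctional H) :
    scalarSpectralMeasure (r • A + s • B) ρ {α} ≤ scalarSpectralMeasure A ρ {α} := by
  have h := scalarSpectralMeasure_affine_singleton hA ρ hr.ne' (s * α) α
  rw [show r * α + s * α = α by rw [← add_mul, hrs, one_mul]] at h
  rw [← h]
  refine scalarSpectralMeasure_singleton_anti (isSelfAdjoint_affine hA _ _)
    (((IsSelfAdjoint.all r).smul hA).add ((IsSelfAdjoint.all s).smul hB)) ?_ ?_ ρ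
  · calc α • (1 : H →L[ℂ] H) = r • (α • (1 : H →L[ℂ] H)) + (s * α) • (1 : H →L[ℂ] H) := by
          rw [smul_smul, ← add_smul, ← add_mul, hrs, one_mul]
      _ ≤ _ := add_le_add_left (smul_le_smul_of_nonneg_left hAα hr.le) _
  · rw [mul_smul]
    exact add_le_add_right (smul_le_smul_of_nonneg_left hBα hs) _

theorem scalarSpectralMeasure_combo_right {A B : H →L[ℂ] H} (hA : IsSelfAdjoint A)
    (hB : IsSelfAdjoint B) {β r s : ℝ} (hr : 0 < r) (hs : 0 ≤ s) (hrs : r + s = 1)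
    (hAβ : A ≤ β • (1 : H →L[ℂ] H)) (hBβ : B ≤ β • (1 : H →L[ℂ] H))
    (ρ : NormalPositiveFunctional H) :
    scalarSpectralMeasure (r • A + s • B) ρ {β} ≤ scalarSpectralMeasure A ρ {β} := by
  have h := scalarSpectralMeasure_affine_singleton hA ρ hr.ne' (s * β) β
  rw [show r * β + s * β = β by rw [← add_mul, hrs, one_mul]] at h
  rw [← h]
  refine scalarSpectralMeasure_singleton_mono
    (((IsSelfAdjoint.all r).smul hA).add ((IsSelfAdjoint.all s).smul hB))
    (isSelfAdjoint_affine hA _ _) ?_ ?_ ρ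
  · calc _ ≤ r • (β • (1 : H →L[ℂ] H)) + (s * β) • (1 : H →L[ℂ] H) :=
          add_le_add_left (smul_le_smul_of_nonneg_left hAβ hr.le) _
      _ = β • (1 : H →L[ℂ] H) := by
          rw [smul_smul, ← add_smul, ← add_mul, hrs, one_mul]
  · rw [mul_smul]
    exact add_le_add_right (smul_le_smul_of_nonneg_left hBβ hs) _

end Bridge

/-! ### Continuity in the interior and one-sided limits at points of the interval. -/

section ScalarRegularity

variable {f : ℝ → EReal} {J : Set ℝ}

theorem continuousOn_coe_toReal {I : Set ℝ} (hfin : ∀ t ∈ I, ∃ x : ℝ, f t = x)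
    (h : ContinuousOn (fun t => (f t).toReal) I) : ContinuousOn f I := by
  refine (continuous_coe_real_ereal.comp_continuousOn h).congr fun t ht => ?_
  obtain ⟨x, hx⟩ := hfin t ht
  simp [hx]

theorem ExtConvexOn.continuousOn {I : Set ℝ} (hI : I.OrdConnected) (hIo : IsOpen I)
    (hfin : ∀ t ∈ I, ∃ x : ℝ, f t = x) (hf : ExtConvexOn f I) : ContinuousOn f I :=
  continuousOn_coe_toReal hfin <| ConvexOn.continuousOn hIo <|
    hf.toReal (fun t ht => by obtain ⟨x, hx⟩ := hfin t ht; simp [hx])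
      (fun t ht => by obtain ⟨x, hx⟩ := hfin t ht; simp [hx]) hI

/-- Monotonicity supplies one-sided limits `p ≤ f s ≤ q`. The scalar inequality with its upper point
to the right of `s` and its other two points to the left gives `q + 4p ≤ 5p` in the limit, so there
is no jump. -/
theorem ExtOperatorMonotoneOn.continuousOn {I : Set ℝ} (hIo : IsOpen I)
    (hfin : ∀ t ∈ I, ∃ x : ℝ, f t = x) (hf : ExtOperatorMonotoneOn.{u} f I) :
    ContinuousOn f I := by
  have hbot : ∀ t ∈ I, f t ≠ ⊥ := fun t ht => by obtain ⟨x, hx⟩ := hfin t ht; simp [hx]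
  have hco : ∀ t ∈ I, f t = ((f t).toReal : EReal) := fun t ht => by
    obtain ⟨x, hx⟩ := hfin t ht; simp [hx]
  refine continuousOn_coe_toReal hfin fun s hs => ContinuousAt.continuousWithinAt ?_
  set g := fun t => (f t).toReal with hg
  have hmono : MonotoneOn g I := fun x hx y hy hxy => by
    have h := hf.scalar hbot hx hy hxy
    rw [hco x hx, hco y hy] at h
    exact_mod_cast h
  obtain ⟨K, hK, hext⟩ := hf.exists_scalar_inequality hbot
  have hsint : s ∈ interior I := by rwa [hIo.interior_eq]
  obtain ⟨δ, hδ, hδI⟩ := exists_Icc_subset_of_mem_interior hsint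
  have hsub1 : Ioo (s - δ) s ⊆ I := fun x hx => hδI ⟨hx.1.le, by linarith [hx.2]⟩
  have hsub2 : Ioo s (s + δ) ⊆ I := fun x hx => hδI ⟨by linarith [hx.1], hx.2.le⟩
  have hleft := (hmono.mono hsub1).tendsto_nhdsWithin_Ioo_left (nonempty_Ioo.mpr (by linarith))
    ⟨g s, by rintro _ ⟨x, hx, rfl⟩; exact hmono (hsub1 hx) hs hx.2.le⟩
  have hright := (hmono.mono hsub2).tendsto_nhdsWithin_Ioo_right (nonempty_Ioo.mpr (by linarith))
    ⟨g s, by rintro _ ⟨x, hx, rfl⟩; exact hmono hs (hsub2 hx) hx.1.le⟩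
  set p := sSup (g '' Ioo (s - δ) s)
  set q := sInf (g '' Ioo s (s + δ))
  have hps : p ≤ g s := le_of_tendsto hleft (by
    filter_upwards [Ioo_mem_nhdsLT (by linarith : s - δ < s)] with x hx using
      hmono (hsub1 hx) hs hx.2.le)
  have hsq : g s ≤ q := ge_of_tendsto hright (by
    filter_upwards [Ioo_mem_nhdsGT (by linarith : s < s + δ)] with x hx using
      hmono hs (hsub2 hx) hx.1.le)
  have hshift : ∀ k : ℝ, Tendsto (fun e : ℝ => s + k * e) (𝓝[>] 0) (𝓝 s) := fun k => by
    have : Tendsto (fun e : ℝ => s + k * e) (𝓝 0) (𝓝 (s + k * 0)) :=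
      Continuous.tendsto (by fun_prop) 0
    rw [mul_zero, add_zero] at this
    exact this.mono_left nhdsWithin_le_nhds
  have hright' : Tendsto (fun e : ℝ => g (s + 3 * e)) (𝓝[>] 0) (𝓝 q) :=
    hright.comp (tendsto_nhdsWithin_of_tendsto_nhds_of_eventually_within _ (hshift 3)
      (eventually_mem_nhdsWithin.mono fun e he => by
        have : 0 < e := he
        simp only [mem_Ioi]; linarith))
  have hleft' : ∀ k : ℝ, k < 0 → Tendsto (fun e : ℝ => g (s + k * e)) (𝓝[>] 0) (𝓝 p) :=
    fun k hk => hleft.comp (tendsto_nhdsWithin_of_tendsto_nhds_of_eventually_within _ (hshift k)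
      (eventually_mem_nhdsWithin.mono fun e he => by
        have : k * e < 0 := mul_neg_of_neg_of_pos hk he
        simp only [mem_Iio]; linarith))
  -- The centre is `s - 3e`, so the three points are `s + 3e`, `s - 9e` and `s - 3e`.
  have hpq : q + 4 * p ≤ 5 * p := by
    refine le_of_tendsto_of_tendsto (hright'.add ((hleft' (-9) (by norm_num)).const_mul 4))
      ((hleft' (-3) (by norm_num)).const_mul 5) ?_
    filter_upwards [Ioo_mem_nhdsGT (by positivity : 0 < δ / (K + 9))] with e he
    have he2 : e * (K + 9) < δ := (lt_div_iff₀ (by positivity)).mp he.2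
    have he1 : 0 < e := he.1
    have hKe : 0 < K * e := by positivity
    have h := hext e (s + -3 * e) he1.le
      (fun z hz => hδI ⟨by linarith [hz.1], by linarith [hz.2]⟩)
    rw [show s + -3 * e + 6 * e = s + 3 * e by ring,
      show s + -3 * e - 6 * e = s + -9 * e by ring,
      hco (s + 3 * e) (hδI ⟨by linarith, by linarith⟩),
      hco (s + -9 * e) (hδI ⟨by linarith, by linarith⟩),
      hco (s + -3 * e) (hδI ⟨by linarith, by linarith⟩)] at h
    rw [← EReal.coe_le_coe_iff, EReal.coe_add, EReal.coe_mul, EReal.coe_mul]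
    exact h
  have hp : p = g s := by linarith
  have hq : q = g s := by linarith
  rw [hp] at hleft
  rw [hq] at hright
  exact continuousAt_iff_continuous_left'_right'.mpr ⟨hleft, hright⟩

theorem shiftedCutoff_coe {M α β t x : ℝ} (ht : t ∈ Icc α β) (hx : f t = x) :
    shiftedCutoff f M α β t = ENNReal.ofReal (x + M) := by
  rw [shiftedCutoff_of_mem ht, hx, ← EReal.coe_add, EReal.toENNReal_of_ne_top (EReal.coe_ne_top _),
    EReal.toReal_coe]

/-- At a point of `J`, a one-sided limit property that holds at the left end of `J` and, by
continuity, in the interior. -/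
theorem exists_tendsto_nhdsGT_of_mem (hJ : J.OrdConnected) {R : EReal → EReal → Prop}
    (hR : ∀ x, R x x) (hcont : ContinuousOn f (interior J))
    (hend : ∀ a : ℝ, IsLeast J a → ∃ l : EReal, l ≠ ⊥ ∧ Tendsto f (𝓝[>] a) (𝓝 l) ∧ R l (f a))
    {α β : ℝ} (hα : α ∈ J) (hβ : β ∈ J) (hαβ : α < β) :
    ∃ l : EReal, Tendsto f (𝓝[>] α) (𝓝 l) ∧ R l (f α) := by
  by_cases h : α ∈ interior J
  · exact ⟨f α, ((hcont.continuousAt (isOpen_interior.mem_nhds h)).mono_left nhdsWithin_le_nhds),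
      hR _⟩
  · obtain ⟨l, -, hl, hle⟩ := hend α ⟨hα, fun x hx => by
      by_contra! hlt
      exact h (Ioo_subset_interior_of_mem hJ hx hβ ⟨hlt, hαβ⟩)⟩
    exact ⟨l, hl, hle⟩

theorem exists_tendsto_nhdsLT_of_mem (hJ : J.OrdConnected) {R : EReal → EReal → Prop}
    (hR : ∀ x, R x x) (hcont : ContinuousOn f (interior J))
    (hend : ∀ b : ℝ, IsGreatest J b → ∃ l : EReal, l ≠ ⊥ ∧ Tendsto f (𝓝[<] b) (𝓝 l) ∧ R l (f b))
    {α β : ℝ} (hα : α ∈ J) (hβ : β ∈ J) (hαβ : α < β) :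
    ∃ l : EReal, Tendsto f (𝓝[<] β) (𝓝 l) ∧ R l (f β) := by
  by_cases h : β ∈ interior J
  · exact ⟨f β, ((hcont.continuousAt (isOpen_interior.mem_nhds h)).mono_left nhdsWithin_le_nhds),
      hR _⟩
  · obtain ⟨l, -, hl, hle⟩ := hend β ⟨hβ, fun x hx => by
      by_contra! hlt
      exact h (Ioo_subset_interior_of_mem hJ hα hx ⟨hαβ, hlt⟩)⟩
    exact ⟨l, hl, hle⟩

end ScalarRegularity

/-! ### Splitting off the endpoint jumps. -/

section Jumps

variable {f : ℝ → EReal} {M α β : ℝ} {l l' : EReal}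

theorem lintegral_shiftedCutoff_eq_add_jumps (hαβ : α < β) (hl : l ≤ f α) (hl' : l' ≤ f β)
    {μ : Measure ℝ} (hμ : ∀ᵐ t ∂μ, t ∈ Icc α β) :
    ∫⁻ t, shiftedCutoff f M α β t ∂μ
      = ∫⁻ t, shiftedCutoff (replaceEndpoints f α β l l') M α β t ∂μ
        + (shiftedCutoff f M α β α - (l + (M : EReal)).toENNReal) * μ {α}
        + (shiftedCutoff f M α β β - (l' + (M : EReal)).toENNReal) * μ {β} := by
  rw [← lintegral_indicator_singleton_const, ← lintegral_indicator_singleton_const,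
    ← lintegral_add_right _ (measurable_const.indicator (measurableSet_singleton _)),
    ← lintegral_add_right _ (measurable_const.indicator (measurableSet_singleton _))]
  refine lintegral_congr_ae ?_
  filter_upwards [hμ] with t ht
  have hα : α ∈ Icc α β := left_mem_Icc.mpr hαβ.le
  have hβ : β ∈ Icc α β := right_mem_Icc.mpr hαβ.le
  rcases ht.1.eq_or_lt with rfl | h1
  · rw [shiftedCutoff_of_mem (f := replaceEndpoints f α β l l') hα, replaceEndpoints_left hαβ,
      indicator_of_mem (mem_singleton _), indicator_of_notMem (by simp [hαβ.ne]), add_zero,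
      add_tsub_cancel_of_le]
    rw [shiftedCutoff_of_mem hα]
    exact EReal.toENNReal_le_toENNReal (add_le_add_left hl _)
  rcases ht.2.eq_or_lt with rfl | h2
  · rw [shiftedCutoff_of_mem (f := replaceEndpoints f α t l l') hβ, replaceEndpoints_right,
      indicator_of_mem (mem_singleton _), indicator_of_notMem (by simp [hαβ.ne']), add_zero,
      add_tsub_cancel_of_le]
    rw [shiftedCutoff_of_mem hβ]
    exact EReal.toENNReal_le_toENNReal (add_le_add_left hl' _)
  · rw [shiftedCutoff_of_mem ht, shiftedCutoff_of_mem ht, replaceEndpoints_of_mem_Ioo ⟨h1, h2⟩,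
      indicator_of_notMem (by simp [h1.ne']), indicator_of_notMem (by simp [h2.ne]), add_zero,
      add_zero]

/-- In the monotone case `f` jumps upward just after `α`, so its left jump is added on the other
side instead of being subtracted in `ℝ≥0∞`. -/
theorem lintegral_shiftedCutoff_add_jump_eq_add_jump (hαβ : α < β) (hl : f α ≤ l) (hl' : l' ≤ f β)
    {μ : Measure ℝ} (hμ : ∀ᵐ t ∂μ, t ∈ Icc α β) :
    ∫⁻ t, shiftedCutoff f M α β t ∂μ
        + ((l + (M : EReal)).toENNReal - shiftedCutoff f M α β α) * μ {α}
      = ∫⁻ t, shiftedCutoff (replaceEndpoints f α β l l') M α β t ∂μ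
        + (shiftedCutoff f M α β β - (l' + (M : EReal)).toENNReal) * μ {β} := by
  rw [← lintegral_indicator_singleton_const, ← lintegral_indicator_singleton_const,
    ← lintegral_add_right _ (measurable_const.indicator (measurableSet_singleton _)),
    ← lintegral_add_right _ (measurable_const.indicator (measurableSet_singleton _))]
  refine lintegral_congr_ae ?_
  filter_upwards [hμ] with t ht
  have hα : α ∈ Icc α β := left_mem_Icc.mpr hαβ.le
  have hβ : β ∈ Icc α β := right_mem_Icc.mpr hαβ.le
  rcases ht.1.eq_or_lt with rfl | h1
  · rw [shiftedCutoff_of_mem (f := replaceEndpoints f α β l l') hα, replaceEndpoints_left hαβ,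
      indicator_of_mem (mem_singleton _), indicator_of_notMem (by simp [hαβ.ne]), add_zero,
      add_tsub_cancel_of_le]
    rw [shiftedCutoff_of_mem hα]
    exact EReal.toENNReal_le_toENNReal (add_le_add_left hl _)
  rcases ht.2.eq_or_lt with rfl | h2
  · rw [shiftedCutoff_of_mem (f := replaceEndpoints f α t l l') hβ, replaceEndpoints_right,
      indicator_of_mem (mem_singleton _), indicator_of_notMem (by simp [hαβ.ne']), add_zero,
      add_tsub_cancel_of_le]
    rw [shiftedCutoff_of_mem hβ]
    exact EReal.toENNReal_le_toENNReal (add_le_add_left hl' _)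
  · rw [shiftedCutoff_of_mem ht, shiftedCutoff_of_mem ht, replaceEndpoints_of_mem_Ioo ⟨h1, h2⟩,
      indicator_of_notMem (by simp [h1.ne']), indicator_of_notMem (by simp [h2.ne]), add_zero]

end Jumps

/-! ### Sufficiency: contraction, limit, and comparison of atoms. -/

section Sufficiency

variable {f : ℝ → EReal} {J : Set ℝ}

theorem exists_nonneg_lower_bound (hlb : LocallyBoundedBelowOn f J) {α β : ℝ}
    (hsub : Icc α β ⊆ J) : ∃ M : ℝ, 0 ≤ M ∧ ∀ t ∈ Icc α β, ((-M : ℝ) : EReal) ≤ f t := by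
  obtain ⟨m, hm⟩ := hlb _ hsub isCompact_Icc
  refine ⟨|m|, abs_nonneg m, fun t ht => le_trans ?_ (hm t ht)⟩
  exact_mod_cast neg_abs_le m

theorem interior_nonempty_of_two_points (hJ : J.OrdConnected)
    (hfin : ∃ s ∈ J, ∃ t ∈ J, s < t ∧ f s ≠ ⊤ ∧ f t ≠ ⊤) : (interior J).Nonempty := by
  obtain ⟨s, hs, t, ht, hst, -, -⟩ := hfin
  exact (nonempty_Ioo.mpr hst).mono (Ioo_subset_interior_of_mem hJ hs ht)

/-- The shift by 2 keeps the contraction parameter strictly below 1 already at `n = 0`. -/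
theorem tendsto_one_div_add_two : Tendsto (fun n : ℕ => 1 / ((n : ℝ) + 2)) atTop (𝓝 0) :=
  tendsto_const_nhds.div_atTop (tendsto_atTop_add_const_right _ _ tendsto_natCast_atTop_atTop)

theorem extOperatorConvexOn_of_interior (hJ : J.OrdConnected)
    (hborel : Measurable (fun t : J => f t)) (hlb : LocallyBoundedBelowOn f J)
    (hne : (interior J).Nonempty) (hreal : ∀ t ∈ interior J, ∃ x : ℝ, f t = (x : EReal))
    (hf : ExtOperatorConvexOn.{u} f (interior J))
    (ha : ∀ a : ℝ, IsLeast J a → ∃ l : EReal, l ≠ ⊥ ∧ Tendsto f (𝓝[>] a) (𝓝 l) ∧ l ≤ f a)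
    (hb : ∀ b : ℝ, IsGreatest J b → ∃ l : EReal, l ≠ ⊥ ∧ Tendsto f (𝓝[<] b) (𝓝 l) ∧ l ≤ f b) :
    ExtOperatorConvexOn.{u} f J := by
  intro H _ _ _ A hA B hB r h0 h1 ρ
  obtain ⟨c, hc⟩ := hne
  obtain ⟨α, hα, β, hβ, hcαβ, hspA, hspB⟩ := exists_Icc_of_spectra hA.2 hB.2 hc
  have hαβ : α < β := hcαβ.1.trans hcαβ.2
  have hsub : Icc α β ⊆ J := hJ.out hα hβ
  have hIoo : Ioo α β ⊆ interior J := Ioo_subset_interior_of_mem hJ hα hβ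
  have hconv : ExtConvexOn f (interior J) := hf.extConvexOn hJ.interior
    fun t ht => by obtain ⟨x, hx⟩ := hreal t ht; simp [hx]
  have hcont := hconv.continuousOn hJ.interior isOpen_interior hreal
  obtain ⟨l, hl, hlα⟩ := exists_tendsto_nhdsGT_of_mem hJ (R := (· ≤ ·)) le_refl hcont ha hα hβ hαβ
  obtain ⟨l', hl', hlβ⟩ := exists_tendsto_nhdsLT_of_mem hJ (R := (· ≤ ·)) le_refl hcont hb hα hβ hαβ
  obtain ⟨M, hM, hfM⟩ := exists_nonneg_lower_bound hlb hsub
  have hmeas : Measurable fun t : Icc α β => f t := hborel.comp (measurable_inclusion hsub)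
  have hfc : f c ≠ ⊤ := by obtain ⟨x, hx⟩ := hreal c hc; simp [hx]
  -- After the shift by `M` the values are nonnegative, so a convex combination of two of them is at
  -- most their sum.
  have hdom : ∀ t ∈ Ioo α β, ∀ e : ℝ, 0 < e → e < 1 →
      shiftedCutoff f M α β ((1 - e) * t + e * c)
        ≤ shiftedCutoff f M α β t + shiftedCutoff f M α β c := by
    intro t ht e he0 he1
    have hz := combo_mem_Ioo hcαβ he0 he1 (Ioo_subset_Icc_self ht)
    have h := hconv t (hIoo ht) c hc e he0 he1
    obtain ⟨x, hx⟩ := hreal t (hIoo ht)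
    obtain ⟨y, hy⟩ := hreal c hc
    obtain ⟨z, hz'⟩ := hreal _ (hIoo hz)
    have hx0 := hfM t (Ioo_subset_Icc_self ht)
    have hy0 := hfM c (Ioo_subset_Icc_self hcαβ)
    rw [shiftedCutoff_coe (Ioo_subset_Icc_self ht) hx,
      shiftedCutoff_coe (Ioo_subset_Icc_self hcαβ) hy,
      shiftedCutoff_coe (Ioo_subset_Icc_self hz) hz']
    rw [hx] at hx0
    rw [hy] at hy0
    rw [hx, hy, hz'] at h
    have hx1 : -M ≤ x := by exact_mod_cast hx0
    have hy1 : -M ≤ y := by exact_mod_cast hy0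
    have h' : z ≤ (1 - e) * x + e * y := by exact_mod_cast h
    rw [← ENNReal.ofReal_add (by linarith) (by linarith)]
    refine ENNReal.ofReal_le_ofReal ?_
    nlinarith [mul_nonneg he0.le (by linarith : 0 ≤ x + M),
      mul_nonneg (by linarith : 0 ≤ 1 - e) (by linarith : 0 ≤ y + M)]
  have hr' : 0 < 1 - r := by linarith
  have hAb := (spectrum_subset_Icc_iff hA.1).mp hspA
  have hBb := (spectrum_subset_Icc_iff hB.1).mp hspB
  set C := (1 - r) • A + r • B with hCdef
  have hC : IsSelfAdjoint C :=
    ((IsSelfAdjoint.all (1 - r)).smul hA.1).add ((IsSelfAdjoint.all r).smul hB.1)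
  have hspC : spectrum ℝ C ⊆ Icc α β := by
    have hsum : ∀ x : ℝ, (1 - r) • (x • (1 : H →L[ℂ] H)) + r • (x • (1 : H →L[ℂ] H)) = x • 1 :=
      fun x => by module
    refine (spectrum_subset_Icc_iff hC).mpr ⟨?_, ?_⟩
    · rw [← hsum α]
      exact add_le_add (smul_le_smul_of_nonneg_left hAb.1 hr'.le)
        (smul_le_smul_of_nonneg_left hBb.1 h0.le)
    · rw [← hsum β]
      exact add_le_add (smul_le_smul_of_nonneg_left hAb.2 hr'.le)
        (smul_le_smul_of_nonneg_left hBb.2 h0.le)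
  have hae : ∀ {X : H →L[ℂ] H}, spectrum ℝ X ⊆ Icc α β →
      ∀ᵐ t ∂(scalarSpectralMeasure X ρ), t ∈ Icc α β := fun {X} hX =>
    (ae_mem_spectrum X ρ).mono fun t ht => hX ht
  have hbridge : ∀ {X : H →L[ℂ] H}, IsSelfAdjoint X → spectrum ℝ X ⊆ Icc α β → _ :=
    fun {X} hX hs => extApply_add_eq_lintegral_shiftedCutoff hX ρ hM hs hfM hmeas
  refine (EReal.le_combo_iff h0 h1 (hbridge hA.1 hspA) (hbridge hB.1 hspB)
    (hbridge hC hspC)).mpr ?_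
  have hlim : ∀ {X : H →L[ℂ] H}, spectrum ℝ X ⊆ Icc α β → _ := fun {X} hX =>
    tendsto_lintegral_shiftedCutoff hcαβ hmeas (hcont.mono hIoo) hl hl' hfc hdom
      (hae hX) (e := fun n : ℕ => 1 / ((n : ℝ) + 2)) (fun n => by positivity)
      (fun n => by rw [div_lt_one (by positivity)]; linarith [(Nat.cast_nonneg n : (0 : ℝ) ≤ n)])
      tendsto_one_div_add_two
  -- Contraction commutes with convex combinations, so the inequality on the interior applies to the
  -- contracted operators; its limit is the inequality for the modified function.
  have hreg := le_of_tendsto_of_tendsto' (hlim hspC)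
    ((ENNReal.Tendsto.const_mul (a := ENNReal.ofReal (1 - r)) (hlim hspA)
      (.inr ENNReal.ofReal_ne_top)).add
    (ENNReal.Tendsto.const_mul (a := ENNReal.ofReal r) (hlim hspB)
      (.inr ENNReal.ofReal_ne_top))) fun n => by
    set e : ℝ := 1 / ((n : ℝ) + 2) with he
    have he0 : 0 < e := by positivity
    have he1 : e < 1 := by
      rw [he, div_lt_one (by positivity)]; linarith [(Nat.cast_nonneg n : (0 : ℝ) ≤ n)]
    obtain ⟨mA, sA⟩ := contraction_mem hIoo hcαβ hA.1 hspA he0 he1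
    obtain ⟨mB, sB⟩ := contraction_mem hIoo hcαβ hB.1 hspB he0 he1
    obtain ⟨mC, sC⟩ := contraction_mem hIoo hcαβ hC hspC he0 he1
    have h := hf H _ mA _ mB r h0 h1 ρ
    have hcombo : (1 - r) • ((1 - e) • A + (e * c) • (1 : H →L[ℂ] H))
        + r • ((1 - e) • B + (e * c) • (1 : H →L[ℂ] H))
        = (1 - e) • C + (e * c) • (1 : H →L[ℂ] H) := by rw [hCdef]; module
    rw [hcombo, EReal.le_combo_iff h0 h1 (hbridge mA.1 sA) (hbridge mB.1 sB) (hbridge mC.1 sC)] at h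
    have hFm := measurable_shiftedCutoff (M := M) hmeas
    rwa [lintegral_scalarSpectralMeasure_affine hA.1 _ _ _ hFm,
      lintegral_scalarSpectralMeasure_affine hB.1 _ _ _ hFm,
      lintegral_scalarSpectralMeasure_affine hC _ _ _ hFm] at h
  -- The atom of `C` is below each of the atoms of `A` and `B`, hence below their weighted mean.
  have hatom : ∀ x y z : ℝ≥0∞, x ≤ y → x ≤ z →
      x ≤ ENNReal.ofReal (1 - r) * y + ENNReal.ofReal r * z := fun x y z h2 h3 => by
    calc x = (ENNReal.ofReal (1 - r) + ENNReal.ofReal r) * x := by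
          rw [← ENNReal.ofReal_add hr'.le h0.le]; simp
      _ ≤ _ := by rw [add_mul]; gcongr
  have hswap : C = r • B + (1 - r) • A := add_comm _ _
  have hCα := hatom _ _ _
    (scalarSpectralMeasure_combo_left hA.1 hB.1 hr' h0.le (by ring) hAb.1 hBb.1 ρ)
    (hswap ▸ scalarSpectralMeasure_combo_left hB.1 hA.1 h0 hr'.le (by ring) hBb.1 hAb.1 ρ)
  have hCβ := hatom _ _ _
    (scalarSpectralMeasure_combo_right hA.1 hB.1 hr' h0.le (by ring) hAb.2 hBb.2 ρ)
    (hswap ▸ scalarSpectralMeasure_combo_right hB.1 hA.1 h0 hr'.le (by ring) hBb.2 hAb.2 ρ)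
  rw [lintegral_shiftedCutoff_eq_add_jumps hαβ hlα hlβ (hae hspA),
    lintegral_shiftedCutoff_eq_add_jumps hαβ hlα hlβ (hae hspB),
    lintegral_shiftedCutoff_eq_add_jumps hαβ hlα hlβ (hae hspC)]
  refine (add_le_add (add_le_add hreg (mul_le_mul_right hCα _)) (mul_le_mul_right hCβ _)).trans
    (le_of_eq ?_)
  ring

theorem extOperatorMonotoneOn_of_interior (hJ : J.OrdConnected)
    (hborel : Measurable (fun t : J => f t)) (hlb : LocallyBoundedBelowOn f J)
    (hne : (interior J).Nonempty) (hreal : ∀ t ∈ interior J, ∃ x : ℝ, f t = (x : EReal))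
    (hf : ExtOperatorMonotoneOn.{u} f (interior J))
    (ha : ∀ a : ℝ, IsLeast J a → ∃ l : EReal, l ≠ ⊥ ∧ Tendsto f (𝓝[>] a) (𝓝 l) ∧ f a ≤ l)
    (hb : ∀ b : ℝ, IsGreatest J b → ∃ l : EReal, l ≠ ⊥ ∧ Tendsto f (𝓝[<] b) (𝓝 l) ∧ l ≤ f b) :
    ExtOperatorMonotoneOn.{u} f J := by
  intro H _ _ _ A hA B hB hAB ρ
  obtain ⟨c, hc⟩ := hne
  obtain ⟨α, hα, β, hβ, hcαβ, hspA, hspB⟩ := exists_Icc_of_spectra hA.2 hB.2 hc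
  have hαβ : α < β := hcαβ.1.trans hcαβ.2
  have hsub : Icc α β ⊆ J := hJ.out hα hβ
  have hIoo : Ioo α β ⊆ interior J := Ioo_subset_interior_of_mem hJ hα hβ
  have hbot : ∀ t ∈ interior J, f t ≠ ⊥ :=
    fun t ht => by obtain ⟨x, hx⟩ := hreal t ht; simp [hx]
  have hmono : MonotoneOn f (interior J) := fun x hx y hy => hf.scalar hbot hx hy
  have hcont := hf.continuousOn isOpen_interior hreal
  obtain ⟨l, hl, hlα⟩ := exists_tendsto_nhdsGT_of_mem hJ (R := (· ≥ ·)) le_refl hcont ha hα hβ hαβ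
  obtain ⟨l', hl', hlβ⟩ := exists_tendsto_nhdsLT_of_mem hJ (R := (· ≤ ·)) le_refl hcont hb hα hβ hαβ
  obtain ⟨M, hM, hfM⟩ := exists_nonneg_lower_bound hlb hsub
  have hmeas : Measurable fun t : Icc α β => f t := hborel.comp (measurable_inclusion hsub)
  have hfc : f c ≠ ⊤ := by obtain ⟨x, hx⟩ := hreal c hc; simp [hx]
  have hdom : ∀ t ∈ Ioo α β, ∀ e : ℝ, 0 < e → e < 1 →
      shiftedCutoff f M α β ((1 - e) * t + e * c)
        ≤ shiftedCutoff f M α β t + shiftedCutoff f M α β c := by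
    intro t ht e he0 he1
    have hz := combo_mem_Ioo hcαβ he0 he1 (Ioo_subset_Icc_self ht)
    have hle : ∀ s ∈ Ioo α β, (1 - e) * t + e * c ≤ s →
        shiftedCutoff f M α β ((1 - e) * t + e * c) ≤ shiftedCutoff f M α β s := fun s hs h => by
      rw [shiftedCutoff_of_mem (Ioo_subset_Icc_self hz),
        shiftedCutoff_of_mem (Ioo_subset_Icc_self hs)]
      exact EReal.toENNReal_le_toENNReal (add_le_add_left (hmono (hIoo hz) (hIoo hs) h) _)
    -- The contracted point lies between `t` and `c`, so by monotonicity its value is at most the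
    -- value at the larger of the two.
    rcases le_total t c with h | h
    · exact (hle c hcαβ (by nlinarith)).trans le_add_self
    · exact (hle t ht (by nlinarith)).trans le_self_add
  have hAb := (spectrum_subset_Icc_iff hA.1).mp hspA
  have hBb := (spectrum_subset_Icc_iff hB.1).mp hspB
  have hae : ∀ {X : H →L[ℂ] H}, spectrum ℝ X ⊆ Icc α β →
      ∀ᵐ t ∂(scalarSpectralMeasure X ρ), t ∈ Icc α β := fun {X} hX =>
    (ae_mem_spectrum X ρ).mono fun t ht => hX ht
  have hbridge : ∀ {X : H →L[ℂ] H}, IsSelfAdjoint X → spectrum ℝ X ⊆ Icc α β → _ :=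
    fun {X} hX hs => extApply_add_eq_lintegral_shiftedCutoff hX ρ hM hs hfM hmeas
  rw [← EReal.add_coe_le_add_coe_iff (M * (ρ.toFun 1).re), hbridge hA.1 hspA, hbridge hB.1 hspB,
    EReal.coe_ennreal_le_coe_ennreal_iff]
  have hlim : ∀ {X : H →L[ℂ] H}, spectrum ℝ X ⊆ Icc α β → _ := fun {X} hX =>
    tendsto_lintegral_shiftedCutoff hcαβ hmeas (hcont.mono hIoo) hl hl' hfc hdom
      (hae hX) (e := fun n : ℕ => 1 / ((n : ℝ) + 2)) (fun n => by positivity)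
      (fun n => by rw [div_lt_one (by positivity)]; linarith [(Nat.cast_nonneg n : (0 : ℝ) ≤ n)])
      tendsto_one_div_add_two
  have hreg := le_of_tendsto_of_tendsto' (hlim hspA) (hlim hspB) fun n => by
    set e : ℝ := 1 / ((n : ℝ) + 2) with he
    have he0 : 0 < e := by positivity
    have he1 : e < 1 := by
      rw [he, div_lt_one (by positivity)]; linarith [(Nat.cast_nonneg n : (0 : ℝ) ≤ n)]
    obtain ⟨mA, sA⟩ := contraction_mem hIoo hcαβ hA.1 hspA he0 he1
    obtain ⟨mB, sB⟩ := contraction_mem hIoo hcαβ hB.1 hspB he0 he1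
    have h := hf H _ mA _ mB
      (add_le_add_left (smul_le_smul_of_nonneg_left hAB (by linarith : 0 ≤ 1 - e)) _) ρ
    rw [← EReal.add_coe_le_add_coe_iff (M * (ρ.toFun 1).re), hbridge mA.1 sA, hbridge mB.1 sB,
      EReal.coe_ennreal_le_coe_ennreal_iff] at h
    have hFm := measurable_shiftedCutoff (M := M) hmeas
    rwa [lintegral_scalarSpectralMeasure_affine hA.1 _ _ _ hFm,
      lintegral_scalarSpectralMeasure_affine hB.1 _ _ _ hFm] at h
  -- Finiteness of `l` makes the left jump term finite, so that it can be cancelled at the end.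
  have hlc : l ≤ f c := le_of_tendsto hl (by
    filter_upwards [Ioo_mem_nhdsGT hcαβ.1] with t ht using
      hmono (hIoo ⟨ht.1, ht.2.trans hcαβ.2⟩) hc ht.2.le)
  have hltop : (l + (M : EReal)).toENNReal ≠ ⊤ := by
    rw [Ne, EReal.toENNReal_eq_top_iff]
    exact EReal.add_ne_top (ne_top_of_le_ne_top hfc hlc) (EReal.coe_ne_top M)
  have hatomα := scalarSpectralMeasure_singleton_anti hA.1 hB.1 hAb.1 hAB ρ
  have hatomβ := scalarSpectralMeasure_singleton_mono hA.1 hB.1 hBb.2 hAB ρ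
  have hEA := lintegral_shiftedCutoff_add_jump_eq_add_jump (M := M) hαβ hlα hlβ (hae hspA)
  have hEB := lintegral_shiftedCutoff_add_jump_eq_add_jump (M := M) hαβ hlα hlβ (hae hspB)
  have hfinite : ((l + (M : EReal)).toENNReal - shiftedCutoff f M α β α)
      * scalarSpectralMeasure A ρ {α} ≠ ⊤ :=
    ENNReal.mul_ne_top (ENNReal.sub_ne_top hltop) (measure_ne_top _ _)
  refine (ENNReal.add_le_add_iff_right hfinite).mp ?_
  -- The jump term of `A` at `α` is added to both sides. The atom at `β` grows from `A` to `B` and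
  -- the atom at `α` shrinks, so both endpoint corrections have the right sign.
  calc _ = _ := hEA
    _ ≤ _ := add_le_add hreg (mul_le_mul_right hatomβ _)
    _ = _ := hEB.symm
    _ ≤ _ := add_le_add_right (mul_le_mul_right hatomα _) _

end Sufficiency

theorem theorem3p7 (J : Set ℝ) (hJ : J.OrdConnected) (f : ℝ → EReal)
    (hf_bot : ∀ t ∈ J, f t ≠ ⊥) (hf_borel : Measurable (fun t : J => f t))
    (hf_lb : LocallyBoundedBelowOn f J)
    (hf_fin : ∃ s ∈ J, ∃ t ∈ J, s ≠ t ∧ f s ≠ ⊤ ∧ f t ≠ ⊤) :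
    (ExtOperatorConvexOn.{u} f J ↔
      (∀ t ∈ interior J, ∃ x : ℝ, f t = (x : EReal)) ∧
      ExtOperatorConvexOn.{u} f (interior J) ∧
      (∀ a : ℝ, IsLeast J a → ∃ l : EReal, l ≠ ⊥ ∧ Tendsto f (𝓝[>] a) (𝓝 l) ∧ l ≤ f a) ∧
      (∀ b : ℝ, IsGreatest J b → ∃ l : EReal, l ≠ ⊥ ∧ Tendsto f (𝓝[<] b) (𝓝 l) ∧ l ≤ f b)) ∧
    (ExtOperatorMonotoneOn.{u} f J ↔
      (∀ t ∈ interior J, ∃ x : ℝ, f t = (x : EReal)) ∧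
      ExtOperatorMonotoneOn.{u} f (interior J) ∧
      (∀ a : ℝ, IsLeast J a → ∃ l : EReal, l ≠ ⊥ ∧ Tendsto f (𝓝[>] a) (𝓝 l) ∧ f a ≤ l) ∧
      (∀ b : ℝ, IsGreatest J b → ∃ l : EReal, l ≠ ⊥ ∧ Tendsto f (𝓝[<] b) (𝓝 l) ∧ l ≤ f b)) := by
  have hfin : ∃ s ∈ J, ∃ t ∈ J, s < t ∧ f s ≠ ⊤ ∧ f t ≠ ⊤ := by
    obtain ⟨s, hs, t, ht, hst, h1, h2⟩ := hf_fin
    rcases hst.lt_or_gt with h | h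
    · exact ⟨s, hs, t, ht, h, h1, h2⟩
    · exact ⟨t, ht, s, hs, h, h2, h1⟩
  have hne := interior_nonempty_of_two_points hJ hfin
  have hreal : (∀ t ∈ interior J, f t ≠ ⊤) → ∀ t ∈ interior J, ∃ x : ℝ, f t = (x : EReal) :=
    fun h t ht => ⟨_, (EReal.coe_toReal (h t ht) (hf_bot t (interior_subset ht))).symm⟩
  refine ⟨⟨fun hf => ⟨hreal (hf.real_on_interior hJ hf_bot hfin), hf.mono interior_subset,
      fun a ha => hf.tendsto_left hJ hf_bot hf_lb hfin ha,
      fun b hb => hf.tendsto_right hJ hf_bot hf_lb hfin hb⟩,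
    fun ⟨h1, h2, h3, h4⟩ => extOperatorConvexOn_of_interior hJ hf_borel hf_lb hne h1 h2 h3 h4⟩,
    ⟨fun hf => ⟨hreal (hf.real_on_interior hJ hf_bot hfin), hf.mono interior_subset,
      fun a ha => hf.tendsto_left hJ hf_bot hfin ha,
      fun b hb => hf.tendsto_right hJ hf_bot hfin hb⟩,
    fun ⟨h1, h2, h3, h4⟩ => extOperatorMonotoneOn_of_interior hJ hf_borel hf_lb hne h1 h2 h3 h4⟩⟩
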